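/- Let $d\ge 1$, $\mathcal H_r=\ell^2(\mathbb Z)$ with canonical basis $(\Psi_j)_{j\in\mathbb Z}$ and $\mathcal H_s=\ell^2(\{0,\dots,d-1\})$ with canonical basis $(e_j)$. Let $b_j^{\#}$ and $a_j^{\#}$ be the fermionic annihilation/creation operators on the antisymmetric Fock spaces $\mathcal F_-(\mathcal H_r)$ and $\mathcal F_-(\mathcal H_s)$, let $\mathcal B$ be the $C^*$-algebra generated by the $b_j$, and $\mathcal A=B(\mathcal F_-(\mathcal H_s))$. On $\mathcal F_-(\mathcal H_r)\otimes\mathcal F_-(\mathcal H_s)$ let $$U=(\Gamma(S)\otimes\Gamma(S_p))\,K,\qquad K=\exp[-i\alpha(b_0^*\otimes a_0+b_0\otimes a_0^*)],\qquad \alpha\in\mathbb R,$$ where $S\Psi_j=\Psi_{j-1}$, $S_pe_j=e_{j-1}$ with $e_{-1}=e_{d-1}$, and $\Gamma$ is second quantization. Put $\tau^t(X)=U^{*t}XU^t$. Let $\Sigma$ be a bounded operator on $\mathcal H_r$ with $0\le\Sigma\le \mathbb I$ and $[\Sigma,S]=0$, so that $\langle\Psi_j|\Sigma\Psi_k\rangle=\sigma(k-j)$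 for a function $\sigma:\mathbb Z\to\mathbb C$, and let $\omega_\Sigma$ be the gauge-invariant quasi-free state on $\mathcal B$ with $\omega_\Sigma(b^*(\phi_m)\cdots b^*(\phi_1)b(\psi_1)\cdots b(\psi_n))=\delta_{nm}\det(\langle\psi_j|\Sigma\phi_k\rangle)$. Let $\rho$ be any density matrix (positive, of trace one) on $\mathcal F_-(\mathcal H_s)$, and let $\rho_t(A)=(\omega_\Sigma\otimes\rho)(\tau^t(\mathbb I\otimes A))$ be the state of the sample at time $t$. The $p$-body reduced density matrix of a state $\varphi$ of the sample is the operator on $\mathcal H_s^{\wedge p}$ with $$\langle e_{j_1}\wedge\cdots\wedge e_{j_p}|\varphi^{(p)}e_{k_1}\wedge\cdots\wedge e_{k_p}\rangle=\varphi(a_{k_1}^*\cdots a_{k_p}^*a_{j_p}\cdots a_{j_1});$$ write $\rho^{(p)}$ for that of $\rho$ and $\rho^{(p)}_m$ for that of $\rho_{md}$, $m\in\mathbb N$. Let $P_A^{(p)}$ be the orthogonal projection of $\mathcal H_s^{\otimes p}$ onto $\mathcal H_s^{\wedge p}$, let $\sigma^{(s)}$, $s\in\mathbb Z$, be the $d\times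 d$ matrix $\sigma^{(s)}_{j,k}=\sigma(k-j+sd)$, and set $$M(m)=\sum_{r,s=0}^{m-1}\cos(\alpha)^{2(m-1)-(r+s)}\sigma^{(r-s)},\qquad B(m)=\sigma^{(0)}+\sum_{u=1}^{m}\cos^u(\alpha)\,(\sigma^{(u)}+\sigma^{(-u)}).$$ Then for all $m\in\mathbb N$ $$\rho^{(2)}_m=\cos^{4m}(\alpha)\,\rho^{(2)}+2\sin^2(\alpha)\cos^{2m}(\alpha)\,P_A^{(2)}\big(\rho^{(1)}\otimes M(m)\big)P_A^{(2)}+\sin^4(\alpha)\,P_A^{(2)}\big(M(m)\otimes M(m)\big)P_A^{(2)},$$ and $$\rho^{(2)}_{m+1}=\cos^4(\alpha)\,\rho^{(2)}_m+\sin^2(\alpha)\,P_A^{(2)}\Big\{\cos^2(\alpha)\big(B(m)\otimes\rho^{(1)}_m+\rho^{(1)}_m\otimes B(m)\big)+\sin^2(\alpha)\,B(m)\otimes B(m)\Big\}P_A^{(2)}.$$ If $\alpha\notin\pi\mathbb Z$, then $\rho^{(1)}_\infty=\lim_{m\to\infty}B(m)$ exists, $\rho^{(1)}_m\to\rho^{(1)}_\infty$,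 and for all $1\le p\le d$ $$\lim_{m\to\infty}\rho^{(p)}_m=P_A^{(p)}\big(\rho^{(1)}_\infty\otimes\cdots\otimes\rho^{(1)}_\infty\big)P_A^{(p)}.$$ -/

import Mathlib

open scoped ComplexOrder InnerProductSpace Topology
open Filter

noncomputable section

namespace Walkers

/-! ### Square-summable sequences and weighted substitution operators -/

/-- The Hilbert space `ℓ²(κ)`. -/
abbrev L2 (κ : Type) : Type := lp (fun _ : κ => ℂ) 2

/-- The canonical basis vector of `ℓ²(κ)` at `x`. -/
def ket {κ : Type} (x : κ) : L2 κ :=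
  letI := Classical.decEq κ
  lp.single 2 x (1 : ℂ)

theorem ket_apply {κ : Type} [DecidableEq κ] (x y : κ) :
    ket x y = if y = x then 1 else 0 := by
  let := Classical.decEq κ
  split_ifs with h
  · subst h
    exact lp.single_apply_self (E := fun _ : κ => ℂ) 2 y (1 : ℂ)
  · exact lp.single_apply_ne (E := fun _ : κ => ℂ) 2 x (1 : ℂ) h

theorem inner_ket {κ : Type} (x : κ) (f : L2 κ) : ⟪ket x, f⟫_ℂ = f x := by
  let := Classical.decEq κ
  exact (lp.inner_single_left (𝕜 := ℂ) (G := fun _ : κ => ℂ) x (1 : ℂ) f).trans (by simp)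

theorem sum_subst_le {κ : Type} (w : κ → ℂ) (g : κ → κ) (hw : ∀ x, ‖w x‖ ≤ 1)
    (hg : Set.InjOn g {x | w x ≠ 0}) (f : L2 κ) (s : Finset κ) :
    ∑ x ∈ s, ‖w x * f (g x)‖ ^ (2 : ENNReal).toReal
      ≤ ‖f‖ ^ (2 : ENNReal).toReal := by
  classical
  have h2 : 0 < (2 : ENNReal).toReal := by norm_num
  have h1 : ∑ x ∈ s, ‖w x * f (g x)‖ ^ (2 : ENNReal).toReal
      ≤ ∑ x ∈ s.filter (fun x => w x ≠ 0), ‖f (g x)‖ ^ (2 : ENNReal).toReal := by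
    rw [Finset.sum_filter]
    refine Finset.sum_le_sum fun x _ => ?_
    split_ifs with h
    · refine Real.rpow_le_rpow (norm_nonneg _) ?_ h2.le
      rw [norm_mul]
      exact mul_le_of_le_one_left (norm_nonneg _) (hw x)
    · have h0 : w x = 0 := by simpa using h
      simp [h0]
  refine h1.trans ?_
  have hinj : Set.InjOn g (s.filter (fun x => w x ≠ 0) : Finset κ) := by
    intro x hx y hy hxy
    simp only [Finset.coe_filter, Set.mem_ofPred_eq] at hx hy
    exact hg hx.2 hy.2 hxy
  rw [← Finset.sum_image (f := fun y => ‖f y‖ ^ (2 : ENNReal).toReal) hinj]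
  exact lp.sum_rpow_le_norm_rpow h2 f _

/-- The bounded operator `(T f)(x) = w(x) f(g(x))` on `ℓ²(κ)`, for weights `|w| ≤ 1` and a
substitution `g` that is injective where `w ≠ 0`. -/
def substOp {κ : Type} (w : κ → ℂ) (g : κ → κ) (hw : ∀ x, ‖w x‖ ≤ 1)
    (hg : Set.InjOn g {x | w x ≠ 0}) : L2 κ →L[ℂ] L2 κ :=
  LinearMap.mkContinuous
    { toFun := fun f => ⟨fun x => w x * f (g x), memℓp_gen' (sum_subst_le w g hw hg f)⟩
      map_add' := fun f f' => by
        ext x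
        exact mul_add _ _ _
      map_smul' := fun c f => by
        ext x
        exact mul_left_comm _ _ _ }
    1 (fun f => by
      rw [one_mul]
      exact lp.norm_le_of_forall_sum_le (by norm_num) (norm_nonneg f)
        (sum_subst_le w g hw hg f))

@[simp] theorem substOp_apply {κ : Type} (w : κ → ℂ) (g : κ → κ) (hw : ∀ x, ‖w x‖ ≤ 1)
    (hg : Set.InjOn g {x | w x ≠ 0}) (f : L2 κ) (x : κ) :
    (substOp w g hw hg f) x = w x * f (g x) := rfl

/-! ### Fermionic Fock space over `ℓ²(ι)` in the occupation number basis -/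

/-- The antisymmetric Fock space `𝓕₋(ℓ²(ι))`, in its orthonormal basis indexed by the finite
subsets of `ι`: the set `{i₁ < ⋯ < i_q}` stands for `e_{i₁} ∧ ⋯ ∧ e_{i_q}`, the empty set for the
vacuum. -/
abbrev Fock (ι : Type) : Type := L2 (Finset ι)

/-- The sign in `e_j ∧ e_{i₁} ∧ ⋯ ∧ e_{i_q} = ± e_{S ∪ {j}}`, where `S = {i₁ < ⋯ < i_q}`. -/
def wedgeSign {ι : Type} [LinearOrder ι] (j : ι) (S : Finset ι) : ℂ :=
  (-1) ^ (S.filter (fun i => i < j)).card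

/-- The annihilation operator `c_j = c(e_j)`: it maps `e_j ∧ e_S` to `e_S` when `j ∉ S`, and `e_S`
to `0` when `j ∉ S`. -/
def annihilation {ι : Type} [LinearOrder ι] (j : ι) : Fock ι →L[ℂ] Fock ι :=
  substOp (fun S => if j ∈ S then 0 else wedgeSign j S) (fun S => insert j S)
    (fun S => by
      split_ifs
      · simp
      · simp [wedgeSign])
    (fun S hS T hT h => by
      have hS' : j ∉ S := fun hc => hS (by simp [hc])
      have hT' : j ∉ T := fun hc => hT (by simp [hc])
      rw [← Finset.erase_insert hS', ← Finset.erase_insert hT']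
      exact congrArg (fun R => Finset.erase R j) h)

theorem annihilation_apply {ι : Type} [LinearOrder ι] (j : ι) (f : Fock ι) (S : Finset ι) :
    (annihilation j f) S
      = if j ∈ S then 0 else wedgeSign j S * f (insert j S) := by
  refine (substOp_apply _ _ _ _ f S).trans ?_
  split_ifs <;> simp

/-- The creation operator `c_j^* = c^*(e_j)`, the adjoint of `c_j`. -/
def creation {ι : Type} [LinearOrder ι] (j : ι) : Fock ι →L[ℂ] Fock ι :=
  star (annihilation j)

/-- Creation acts on basis vectors by `c_j^* e_S = e_j ∧ e_S`. -/
theorem creation_ket {ι : Type} [LinearOrder ι] (j : ι) (S : Finset ι) :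
    creation j (ket S) = if j ∈ S then 0 else wedgeSign j S • ket (insert j S) := by
  ext T
  rw [← inner_ket T, creation, ContinuousLinearMap.star_eq_adjoint,
    ContinuousLinearMap.adjoint_inner_right, ← inner_conj_symm, inner_ket]
  rw [annihilation_apply]
  by_cases hjS : j ∈ S
  · simp [hjS]
  · rw [if_neg hjS, if_neg hjS, lp.coeFn_smul, Pi.smul_apply, ket_apply, ket_apply]
    by_cases h : T = insert j S
    · simp [h, wedgeSign]
    · simp [h, Ne.symm h]

/-- The permutation operator `e_j ↦ e_{f(j)}` on `ℓ²(ι)`. -/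
def permOp {ι : Type} (f : Equiv.Perm ι) : L2 ι →L[ℂ] L2 ι :=
  substOp (fun _ => 1) (fun j => f.symm j) (fun _ => by simp) f.symm.injective.injOn

/-- The sign in `e_{f(i₁)} ∧ ⋯ ∧ e_{f(i_q)} = ± e_{f(S)}`, where `S = {i₁ < ⋯ < i_q}`: the parity of
the number of inversions of `f` on `S`. -/
def permSign {ι : Type} [LinearOrder ι] (f : Equiv.Perm ι) (S : Finset ι) : ℂ :=
  (-1) ^ ((S ×ˢ S).filter (fun p => p.1 < p.2 ∧ f p.2 < f p.1)).card

/-- The second quantization `Γ(W)` of the permutation operator `W e_j = e_{f(j)}`: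
`Γ(W) e_{i₁} ∧ ⋯ ∧ e_{i_q} = e_{f(i₁)} ∧ ⋯ ∧ e_{f(i_q)}`. -/
def secondQuant {ι : Type} [LinearOrder ι] (f : Equiv.Perm ι) : Fock ι →L[ℂ] Fock ι :=
  substOp (fun T => permSign f (T.map f.symm.toEmbedding)) (fun T => T.map f.symm.toEmbedding)
    (fun T => by simp [permSign]) (Finset.map_injective _).injOn

theorem secondQuant_ket {ι : Type} [LinearOrder ι] (f : Equiv.Perm ι) (S : Finset ι) :
    secondQuant f (ket S) = permSign f S • ket (S.map f.toEmbedding) := by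
  ext T
  simp only [secondQuant, substOp_apply, lp.coeFn_smul, Pi.smul_apply, smul_eq_mul, ket_apply]
  have : T.map f.symm.toEmbedding = S ↔ T = S.map f.toEmbedding := by
    constructor
    · rintro rfl
      ext x
      simp
    · rintro rfl
      ext x
      simp
  by_cases h : T = S.map f.toEmbedding
  · rw [if_pos h, if_pos (this.2 h), this.2 h]
  · rw [if_neg h, if_neg (fun hc => h (this.1 hc))]
    simp

/-! ### The reservoir -/

/-- The shift `j ↦ j - 1` on `ℤ`. -/
def shiftInt : Equiv.Perm ℤ := Equiv.subRight 1

/-- The shift `S Ψ_j = Ψ_{j-1}` on `ℓ²(ℤ)`. -/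
def reservoirShift : L2 ℤ →L[ℂ] L2 ℤ := permOp shiftInt

/-- The C*-algebra `𝓑` generated by the creation and annihilation operators of the reservoir. -/
def reservoirAlgebra : StarSubalgebra ℂ (Fock ℤ →L[ℂ] Fock ℤ) :=
  (StarAlgebra.adjoin ℂ (Set.range (annihilation (ι := ℤ)))).topologicalClosure

theorem annihilation_mem (j : ℤ) : annihilation j ∈ reservoirAlgebra :=
  StarSubalgebra.le_topologicalClosure _ (StarAlgebra.subset_adjoin ℂ _ ⟨j, rfl⟩)

/-- `b_j` as an element of `𝓑`. -/
def b (j : ℤ) : reservoirAlgebra := ⟨annihilation j, annihilation_mem j⟩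

/-- A state `ω` on `𝓑` is the gauge-invariant quasi-free state with density `Sg` if
`ω(b^*(φ_m) ⋯ b^*(φ_1) b(ψ_1) ⋯ b(ψ_n)) = δ_{nm} det (⟨ψ_j, Sg φ_k⟩)`, for all `φ`, `ψ` among
the canonical basis vectors (the general case follows by linearity and continuity). -/
structure IsQuasiFreeState (Sg : L2 ℤ →L[ℂ] L2 ℤ) (ω : reservoirAlgebra →L[ℂ] ℂ) : Prop where
  map_one : ω 1 = 1
  nonneg : ∀ x, 0 ≤ ω (star x * x)
  map_of_eq : ∀ (n : ℕ) (φ ψ : Fin n → ℤ),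
    ω ((List.ofFn fun i => star (b (φ i))).reverse.prod * (List.ofFn fun i => b (ψ i)).prod)
      = (Matrix.of fun j k : Fin n => ⟪ket (ψ j), Sg (ket (φ k))⟫_ℂ).det
  map_of_ne : ∀ (m n : ℕ) (φ : Fin m → ℤ) (ψ : Fin n → ℤ), m ≠ n →
    ω ((List.ofFn fun i => star (b (φ i))).reverse.prod * (List.ofFn fun i => b (ψ i)).prod) = 0

/-! ### The composite system -/

/-- The shift `j ↦ j - 1` on the periodic sample `{0, …, d - 1}`. -/
def shiftSample (d : ℕ) [NeZero d] : Equiv.Perm (Fin d) := Equiv.subRight 1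

/-- `𝓕₋(𝓗_r) ⊗ 𝓕₋(𝓗_s)` with `𝓗_r = ℓ²(ℤ)` and `𝓗_s = ℓ²({0, …, d - 1})`, as the Hilbert sum
`⨁_T 𝓕₋(𝓗_r) ⊗ e_T` over the canonical basis `e_T` of the finite dimensional space `𝓕₋(𝓗_s)`. -/
abbrev Composite (d : ℕ) : Type := PiLp 2 (fun _ : Finset (Fin d) => Fock ℤ)

/-- `ψ ↦ ψ ⊗ e_T`. -/
def incl {d : ℕ} (T : Finset (Fin d)) : Fock ℤ →L[ℂ] Composite d :=
  (PiLp.continuousLinearEquiv 2 ℂ (fun _ : Finset (Fin d) => Fock ℤ)).symm.toContinuousLinearMap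
    ∘L ContinuousLinearMap.single ℂ (fun _ : Finset (Fin d) => Fock ℤ) T

/-- The component of a vector along `e_T`. -/
def compo {d : ℕ} (T : Finset (Fin d)) : Composite d →L[ℂ] Fock ℤ :=
  PiLp.proj 2 (fun _ : Finset (Fin d) => Fock ℤ) T

/-- The operator `A ⊗ B` on the composite system. -/
def tens {d : ℕ} (A : Fock ℤ →L[ℂ] Fock ℤ) (B : Fock (Fin d) →L[ℂ] Fock (Fin d)) :
    Composite d →L[ℂ] Composite d :=
  ∑ T, ∑ T', ⟪ket T, B (ket T')⟫_ℂ • (incl T ∘L A ∘L compo T')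

/-- The block `⟨e_T, X e_{T'}⟩`, an operator on the reservoir. -/
def block {d : ℕ} (X : Composite d →L[ℂ] Composite d) (T T' : Finset (Fin d)) :
    Fock ℤ →L[ℂ] Fock ℤ :=
  compo T ∘L X ∘L incl T'

theorem compo_incl {d : ℕ} (T T' : Finset (Fin d)) (ψ : Fock ℤ) :
    compo T (incl T' ψ) = if T = T' then ψ else 0 := by
  simp only [compo, incl, ContinuousLinearMap.comp_apply, PiLp.proj_apply,
    ContinuousLinearMap.single_apply]
  by_cases h : T = T'
  · subst h
    simp
  · rw [if_neg h]
    exact Pi.single_eq_of_ne (M := fun _ : Finset (Fin d) => Fock ℤ) h ψ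

theorem sum_incl_compo {d : ℕ} (x : Composite d) : ∑ T, incl T (compo T x) = x := by
  refine PiLp.ext fun T => ?_
  have h : ∀ y : Composite d, y.ofLp T = compo T y := fun y => rfl
  rw [h, h, map_sum]
  simp [compo_incl]

theorem block_one {d : ℕ} (T T' : Finset (Fin d)) :
    block (1 : Composite d →L[ℂ] Composite d) T T' = if T = T' then 1 else 0 := by
  ext1 ψ
  simp only [block, ContinuousLinearMap.comp_apply, one_apply_eq_self, compo_incl]
  split_ifs <;> rfl

theorem block_mul {d : ℕ} (X Y : Composite d →L[ℂ] Composite d) (T T' : Finset (Fin d)) :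
    block (X * Y) T T' = ∑ L, block X T L * block Y L T' := by
  ext1 ψ
  simp only [block, ContinuousLinearMap.comp_apply, mul_apply_eq_comp,
    sum_apply]
  rw [← map_sum, ← map_sum, sum_incl_compo]

theorem block_star {d : ℕ} (X : Composite d →L[ℂ] Composite d) (T T' : Finset (Fin d)) :
    block (star X) T T' = star (block X T' T) := by
  have key : ∀ (T : Finset (Fin d)) (ψ : Fock ℤ) (x : Composite d),
      ⟪ψ, compo T x⟫_ℂ = ⟪incl T ψ, x⟫_ℂ := by
    intro T ψ x
    rw [PiLp.inner_apply, Finset.sum_eq_single T]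
    · congr 1
      exact ((compo_incl T T ψ).trans (if_pos rfl)).symm
    · intro T' _ hT
      have : (incl T ψ).ofLp T' = 0 := (compo_incl T' T ψ).trans (if_neg hT)
      simp [this]
    · simp
  refine ContinuousLinearMap.ext fun ψ => ext_inner_left ℂ fun χ => ?_
  simp only [ContinuousLinearMap.star_eq_adjoint, ContinuousLinearMap.adjoint_inner_right, block,
    ContinuousLinearMap.comp_apply]
  rw [key, ContinuousLinearMap.adjoint_inner_right, ← inner_conj_symm, ← key, inner_conj_symm]

theorem block_tens {d : ℕ} (A : Fock ℤ →L[ℂ] Fock ℤ) (B : Fock (Fin d) →L[ℂ] Fock (Fin d))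
    (T T' : Finset (Fin d)) : block (tens A B) T T' = ⟪ket T, B (ket T')⟫_ℂ • A := by
  ext1 ψ
  simp only [block, tens, ContinuousLinearMap.comp_apply, sum_apply,
    smul_apply, map_sum, map_smul, compo_incl]
  rw [Finset.sum_eq_single T, Finset.sum_eq_single T']
  · simp
  · intro L _ hL
    simp [hL]
  · simp
  · intro L _ hL
    simp [hL.symm]
  · simp

/-- The C*-algebra `𝓑 ⊗ 𝓐` with `𝓐 = B(𝓕₋(𝓗_s))` a full matrix algebra: the operators all of whose
blocks lie in `𝓑`. -/
def compositeAlgebra (d : ℕ) : StarSubalgebra ℂ (Composite d →L[ℂ] Composite d) where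
  carrier := {X | ∀ T T', block X T T' ∈ reservoirAlgebra}
  mul_mem' := fun {X Y} hX hY T T' => by
    rw [block_mul]
    exact sum_mem fun L _ => mul_mem (hX T L) (hY L T')
  add_mem' := fun {X Y} hX hY T T' => by
    have : block (X + Y) T T' = block X T T' + block Y T T' := by
      ext1 ψ
      simp [block]
    rw [this]
    exact add_mem (hX T T') (hY T T')
  algebraMap_mem' := fun c T T' => by
    have : block (algebraMap ℂ (Composite d →L[ℂ] Composite d) c) T T'
        = c • block (1 : Composite d →L[ℂ] Composite d) T T' := by
      rw [Algebra.algebraMap_eq_smul_one]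
      ext1 ψ
      simp [block]
    rw [this, block_one]
    refine Subalgebra.smul_mem reservoirAlgebra.toSubalgebra ?_ c
    split_ifs
    · exact one_mem reservoirAlgebra
    · exact zero_mem reservoirAlgebra
  star_mem' := fun {X} hX T T' => by
    rw [block_star]
    exact star_mem (hX T' T)

theorem tens_mem {d : ℕ} {A : Fock ℤ →L[ℂ] Fock ℤ} (hA : A ∈ reservoirAlgebra)
    (B : Fock (Fin d) →L[ℂ] Fock (Fin d)) : tens A B ∈ compositeAlgebra d := by
  intro T T'
  rw [block_tens]
  exact Subalgebra.smul_mem reservoirAlgebra.toSubalgebra hA _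

theorem isClosed_compositeAlgebra (d : ℕ) :
    IsClosed (compositeAlgebra d : Set (Composite d →L[ℂ] Composite d)) := by
  have : (compositeAlgebra d : Set (Composite d →L[ℂ] Composite d))
      = ⋂ T, ⋂ T', (fun X => block X T T') ⁻¹' (reservoirAlgebra : Set _) := by
    ext X
    simp only [Set.mem_iInter]
    rfl
  rw [this]
  refine isClosed_iInter fun T => isClosed_iInter fun T' => ?_
  refine (StarSubalgebra.isClosed_topologicalClosure _).preimage ?_
  unfold block
  fun_prop

/-! ### The dynamics -/

/-- The coupling `K = exp(-iα (b_0^* ⊗ a_0 + b_0 ⊗ a_0^*))`. -/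
def coupling (d : ℕ) [NeZero d] (α : ℝ) : Composite d →L[ℂ] Composite d :=
  NormedSpace.exp ((-Complex.I * (α : ℂ)) •
    (tens (creation (0 : ℤ)) (annihilation (0 : Fin d))
      + tens (annihilation (0 : ℤ)) (creation (0 : Fin d))))

/-- The free evolution `U_F = Γ(S) ⊗ Γ(S_p)`, with `S` and `S_p` the shifts of the reservoir and of
the sample. -/
def freeStep (d : ℕ) [NeZero d] : Composite d →L[ℂ] Composite d :=
  tens (secondQuant shiftInt) (secondQuant (shiftSample d))

/-- The one time step evolution `U = U_F K`. -/
def step (d : ℕ) [NeZero d] (α : ℝ) : Composite d →L[ℂ] Composite d :=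
  freeStep d * coupling d α

/-- The evolution `τ^t(X) = U^{*t} X U^t`. -/
def evolve (d : ℕ) [NeZero d] (α : ℝ) (t : ℕ) (X : Composite d →L[ℂ] Composite d) :
    Composite d →L[ℂ] Composite d :=
  star (step d α ^ t) * X * step d α ^ t

theorem permSign_shiftInt (S : Finset ℤ) : permSign shiftInt S = 1 := by
  unfold permSign shiftInt
  rw [Finset.filter_false_of_mem]
  · simp
  · rintro ⟨x, y⟩ _
    simp only [Equiv.subRight_apply, not_and, not_lt]
    omega

theorem secondQuant_shiftInt_apply (f : Fock ℤ) (T : Finset ℤ) :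
    (secondQuant shiftInt f) T
      = f (T.map shiftInt.symm.toEmbedding) := by
  simp [secondQuant, permSign_shiftInt]

theorem star_secondQuant_shiftInt_apply (f : Fock ℤ) (T : Finset ℤ) :
    (star (secondQuant shiftInt) f) T
      = f (T.map shiftInt.toEmbedding) := by
  rw [← inner_ket T, ContinuousLinearMap.star_eq_adjoint,
    ContinuousLinearMap.adjoint_inner_right, secondQuant_ket, permSign_shiftInt, one_smul,
    inner_ket]

theorem secondQuant_shiftInt_mul_star :
    secondQuant shiftInt * star (secondQuant shiftInt) = 1 := by
  ext f T
  rw [mul_apply_eq_comp, secondQuant_shiftInt_apply, star_secondQuant_shiftInt_apply,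
    one_apply_eq_self]
  refine congrArg _ ?_
  ext x
  simp

theorem star_secondQuant_shiftInt_mul :
    star (secondQuant shiftInt) * secondQuant shiftInt = 1 := by
  ext f T
  rw [mul_apply_eq_comp, star_secondQuant_shiftInt_apply, secondQuant_shiftInt_apply,
    one_apply_eq_self]
  refine congrArg _ ?_
  ext x
  simp

/-- The free evolution of the reservoir maps `b_j` to `b_{j+1}`. -/
theorem conj_annihilation (j : ℤ) :
    star (secondQuant shiftInt) * annihilation j * secondQuant shiftInt
      = annihilation (j + 1) := by
  ext f T
  rw [mul_apply_eq_comp, mul_apply_eq_comp,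
    star_secondQuant_shiftInt_apply]
  rw [annihilation_apply, annihilation_apply, secondQuant_shiftInt_apply]
  have h1 : (j ∈ T.map shiftInt.toEmbedding) ↔ j + 1 ∈ T := by
    simp [shiftInt]
  have h2 : (insert j (T.map shiftInt.toEmbedding)).map shiftInt.symm.toEmbedding
      = insert (j + 1) T := by
    ext x
    simp [shiftInt]
  have h3 : wedgeSign j (T.map shiftInt.toEmbedding) = wedgeSign (j + 1) T := by
    have : (T.map shiftInt.toEmbedding).filter (fun i => i < j)
        = (T.filter (fun i => i < j + 1)).map shiftInt.toEmbedding := by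
      ext x
      simp only [Finset.mem_filter, Finset.mem_map, Equiv.coe_toEmbedding, shiftInt,
        Equiv.subRight_apply]
      constructor
      · rintro ⟨⟨y, hy, rfl⟩, h⟩
        exact ⟨y, ⟨hy, by omega⟩, rfl⟩
      · rintro ⟨y, ⟨hy, h⟩, rfl⟩
        exact ⟨⟨y, hy, rfl⟩, by omega⟩
    unfold wedgeSign
    rw [this, Finset.card_map]
  rw [h2, h3]
  simp only [h1]

theorem conj_mem {A : Fock ℤ →L[ℂ] Fock ℤ} (hA : A ∈ reservoirAlgebra) :
    star (secondQuant shiftInt) * A * secondQuant shiftInt ∈ reservoirAlgebra := by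
  set V := secondQuant shiftInt with hV
  have hVV : ∀ X : Fock ℤ →L[ℂ] Fock ℤ, V * (star V * X) = X := fun X => by
    rw [← mul_assoc, secondQuant_shiftInt_mul_star, one_mul]
  have hadj : ∀ A ∈ StarAlgebra.adjoin ℂ (Set.range (annihilation (ι := ℤ))),
      star V * A * V ∈ reservoirAlgebra := by
    intro A hA
    induction hA using StarAlgebra.adjoin_induction with
    | mem x hx =>
      obtain ⟨j, rfl⟩ := hx
      rw [hV, conj_annihilation]
      exact annihilation_mem _
    | algebraMap r =>
      rw [Algebra.algebraMap_eq_smul_one, mul_smul_comm, mul_one, smul_mul_assoc,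
        star_secondQuant_shiftInt_mul]
      exact Subalgebra.smul_mem reservoirAlgebra.toSubalgebra (one_mem reservoirAlgebra) r
    | add x y _ _ hx hy =>
      rw [mul_add, add_mul]
      exact add_mem hx hy
    | mul x y _ _ hx hy =>
      have : star V * (x * y) * V = (star V * x * V) * (star V * y * V) := by
        simp only [mul_assoc, hVV]
      rw [this]
      exact mul_mem hx hy
    | star x _ hx =>
      have : star V * star x * V = star (star V * x * V) := by
        simp [mul_assoc]
      rw [this]
      exact star_mem hx
  have hcont : Continuous fun A : Fock ℤ →L[ℂ] Fock ℤ => star V * A * V := by fun_prop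
  have hclosed : IsClosed {A : Fock ℤ →L[ℂ] Fock ℤ | star V * A * V ∈ reservoirAlgebra} :=
    IsClosed.preimage hcont (StarSubalgebra.isClosed_topologicalClosure _)
  exact closure_minimal (fun A hA => hadj A hA) hclosed hA

theorem coupling_mem (d : ℕ) [NeZero d] (α : ℝ) : coupling d α ∈ compositeAlgebra d := by
  refine NormedSpace.exp_mem (s := compositeAlgebra d) (isClosed_compositeAlgebra d) ?_
  refine Subalgebra.smul_mem (compositeAlgebra d).toSubalgebra ?_ _
  exact add_mem (tens_mem (star_mem (annihilation_mem 0)) _) (tens_mem (annihilation_mem 0) _)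

theorem evolve_mem (d : ℕ) [NeZero d] (α : ℝ) (t : ℕ) {X : Composite d →L[ℂ] Composite d}
    (hX : X ∈ compositeAlgebra d) : evolve d α t X ∈ compositeAlgebra d := by
  have hfree : ∀ Y ∈ compositeAlgebra d,
      star (freeStep d) * Y * freeStep d ∈ compositeAlgebra d := by
    intro Y hY T T'
    rw [block_mul]
    refine sum_mem fun L _ => ?_
    rw [block_mul, Finset.sum_mul]
    refine sum_mem fun L' _ => ?_
    rw [block_star, freeStep, block_tens, block_tens, star_smul, smul_mul_assoc, smul_mul_assoc,
      mul_smul_comm]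
    exact Subalgebra.smul_mem reservoirAlgebra.toSubalgebra
      (Subalgebra.smul_mem reservoirAlgebra.toSubalgebra (conj_mem (hY L' L)) _) _
  induction t with
  | zero => simpa [evolve] using hX
  | succ t ih =>
    have : evolve d α (t + 1) X
        = star (coupling d α) * (star (freeStep d) * evolve d α t X * freeStep d)
          * coupling d α := by
      simp only [evolve, pow_succ, step, star_mul, mul_assoc]
    rw [this]
    exact mul_mem (mul_mem (star_mem (coupling_mem d α)) (hfree _ ih)) (coupling_mem d α)

/-! ### Initial states and evolved states -/

/-- The trace on `𝓕₋(𝓗_s)`, which has the finite orthonormal basis `ket T`. -/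
def sampleTrace {d : ℕ} (A : Fock (Fin d) →L[ℂ] Fock (Fin d)) : ℂ :=
  ∑ T, ⟪ket T, A (ket T)⟫_ℂ

/-- The product state `ω ⊗ ρ` on `𝓑 ⊗ 𝓐`. -/
def productState {d : ℕ} (ω : reservoirAlgebra →L[ℂ] ℂ)
    (ρ : Fock (Fin d) →L[ℂ] Fock (Fin d)) (X : compositeAlgebra d) : ℂ :=
  ∑ T, ∑ T', ⟪ket T', ρ (ket T)⟫_ℂ * ω ⟨block X.1 T T', X.2 T T'⟩

/-- `(ω ⊗ ρ)(B ⊗ A) = ω(B) tr(ρ A)`. -/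
theorem productState_tens {d : ℕ} (ω : reservoirAlgebra →L[ℂ] ℂ)
    (ρ : Fock (Fin d) →L[ℂ] Fock (Fin d)) (B : reservoirAlgebra)
    (A : Fock (Fin d) →L[ℂ] Fock (Fin d)) :
    productState ω ρ ⟨tens B.1 A, tens_mem B.2 A⟩ = ω B * sampleTrace (ρ * A) := by
  have hb : ∀ T T' : Finset (Fin d),
      (⟨block (tens B.1 A) T T', tens_mem B.2 A T T'⟩ : reservoirAlgebra)
        = ⟪ket T, A (ket T')⟫_ℂ • B := fun T T' => Subtype.ext (block_tens _ _ _ _)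
  have hsum : ∀ v : Fock (Fin d), v = ∑ T, ⟪ket T, v⟫_ℂ • ket T := by
    intro v
    ext T
    rw [lp.coeFn_sum, Finset.sum_apply]
    simp [ket_apply, inner_ket]
  have htr : ∀ T' : Finset (Fin d), ⟪ket T', (ρ * A) (ket T')⟫_ℂ
      = ∑ T, ⟪ket T, A (ket T')⟫_ℂ * ⟪ket T', ρ (ket T)⟫_ℂ := by
    intro T'
    rw [mul_apply_eq_comp]
    conv_lhs => rw [hsum (A (ket T'))]
    rw [map_sum, inner_sum]
    simp only [map_smul, inner_smul_right]
  unfold productState sampleTrace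
  simp only [hb, map_smul, htr, smul_eq_mul]
  rw [Finset.sum_comm, Finset.mul_sum]
  refine Finset.sum_congr rfl fun T' _ => ?_
  rw [Finset.mul_sum]
  refine Finset.sum_congr rfl fun T _ => ?_
  ring

/-- The initial state of the sample: `ρ(A) = tr(ρ A)`. -/
def initialState {d : ℕ} (ρ : Fock (Fin d) →L[ℂ] Fock (Fin d))
    (A : Fock (Fin d) →L[ℂ] Fock (Fin d)) : ℂ :=
  sampleTrace (ρ * A)

/-- The state of the sample at time `t`: `ρ_t(A) = (ω ⊗ ρ)(τ^t(1 ⊗ A))`. -/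
def sampleState (d : ℕ) [NeZero d] (α : ℝ) (ω : reservoirAlgebra →L[ℂ] ℂ)
    (ρ : Fock (Fin d) →L[ℂ] Fock (Fin d)) (t : ℕ) (A : Fock (Fin d) →L[ℂ] Fock (Fin d)) : ℂ :=
  productState ω ρ ⟨evolve d α t (tens 1 A),
    evolve_mem d α t (tens_mem (one_mem reservoirAlgebra) A)⟩

/-! ### Reduced density matrices

Operators on `𝓗_s` and on `𝓗_s^{⊗p}` are written as matrices in the bases `e_j` and
`e_{j_1} ⊗ ⋯ ⊗ e_{j_p}`. -/

/-- Operators on `𝓗_s^{⊗p}`. -/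
abbrev TensorOp (p d : ℕ) : Type := Matrix (Fin p → Fin d) (Fin p → Fin d) ℂ

/-- `A_1 ⊗ ⋯ ⊗ A_p`. -/
def tensorMat {p d : ℕ} (A : Fin p → Matrix (Fin d) (Fin d) ℂ) : TensorOp p d :=
  Matrix.of fun j k => ∏ i, A i (j i) (k i)

/-- `Θ(π) u_1 ⊗ ⋯ ⊗ u_p = u_{π(1)} ⊗ ⋯ ⊗ u_{π(p)}`. -/
def permTensor {p d : ℕ} (π : Equiv.Perm (Fin p)) : TensorOp p d :=
  Matrix.of fun j k => if j = k ∘ π then 1 else 0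

/-- The projection `P_A^{(p)} = (1 / p!) ∑_π ε_π Θ(π)` onto `𝓗_s^{∧p}`. -/
def antisymProj (p d : ℕ) : TensorOp p d :=
  (1 / (p.factorial : ℂ)) • ∑ π : Equiv.Perm (Fin p), ((π.sign : ℤ) : ℂ) • permTensor π

/-- `e_{j_1} ∧ ⋯ ∧ e_{j_p} = (1 / √p!) ∑_π ε_π e_{j_{π(1)}} ⊗ ⋯ ⊗ e_{j_{π(p)}}`. -/
def wedge {p d : ℕ} (j : Fin p → Fin d) : (Fin p → Fin d) → ℂ :=
  (1 / (Real.sqrt p.factorial : ℂ)) •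
    ∑ π : Equiv.Perm (Fin p), ((π.sign : ℤ) : ℂ) • Pi.single (j ∘ π) 1

/-- The operator `a_{k_1}^* ⋯ a_{k_p}^* a_{j_p} ⋯ a_{j_1}` on `𝓕₋(𝓗_s)`. -/
def monomial {p d : ℕ} (k j : Fin p → Fin d) : Fock (Fin d) →L[ℂ] Fock (Fin d) :=
  (List.ofFn fun i => creation (k i)).prod * (List.ofFn fun i => annihilation (j i)).reverse.prod

/-- The `p`-body reduced density matrix of a state `φ` of the sample: the operator on `𝓗_s^{∧p}`
(extended by zero to the orthogonal complement in `𝓗_s^{⊗p}`) with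
`⟨e_{j_1} ∧ ⋯ ∧ e_{j_p}, ρ^{(p)} e_{k_1} ∧ ⋯ ∧ e_{k_p}⟩ = φ(a_{k_1}^* ⋯ a_{k_p}^* a_{j_p} ⋯ a_{j_1})`
in the orthonormal basis `e_{j_1} ∧ ⋯ ∧ e_{j_p}`, `j_1 < ⋯ < j_p`, of `𝓗_s^{∧p}`. -/
def reducedDM {d : ℕ} (p : ℕ) (φ : (Fock (Fin d) →L[ℂ] Fock (Fin d)) → ℂ) : TensorOp p d :=
  ∑ j : Fin p ↪o Fin d, ∑ k : Fin p ↪o Fin d,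
    φ (monomial k j) • Matrix.vecMulVec (wedge j) (star (wedge k))

/-- The one-body reduced density matrix, `⟨e_j, ρ^{(1)} e_k⟩ = φ(a_k^* a_j)`. -/
def oneBody {d : ℕ} (φ : (Fock (Fin d) →L[ℂ] Fock (Fin d)) → ℂ) : Matrix (Fin d) (Fin d) ℂ :=
  Matrix.of fun j k => φ (creation k * annihilation j)

/-- The function `σ(k) = ⟨Ψ_0, Σ Ψ_k⟩`, so that `⟨Ψ_j, Σ Ψ_k⟩ = σ(k - j)` when `Σ` commutes with the
shift. -/
def symb (Sg : L2 ℤ →L[ℂ] L2 ℤ) (k : ℤ) : ℂ := ⟪ket 0, Sg (ket k)⟫_ℂ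

/-- The matrix `σ^{(s)}` with entries `σ(k - j + s d)`. -/
def sigmaMat (d : ℕ) (Sg : L2 ℤ →L[ℂ] L2 ℤ) (s : ℤ) : Matrix (Fin d) (Fin d) ℂ :=
  Matrix.of fun j k => symb Sg ((k : ℤ) - (j : ℤ) + s * (d : ℤ))

/-- `∑_{r,s=0}^{m-1} cos(α)^{2(m-1)-(r+s)} σ^{(r-s)}`. -/
def sigmaSum (d : ℕ) (α : ℝ) (Sg : L2 ℤ →L[ℂ] L2 ℤ) (m : ℕ) : Matrix (Fin d) (Fin d) ℂ :=
  ∑ r ∈ Finset.range m, ∑ s ∈ Finset.range m,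
    (Real.cos α : ℂ) ^ (2 * (m - 1) - (r + s)) • sigmaMat d Sg ((r : ℤ) - (s : ℤ))

/-- `B(m) = σ^{(0)} + ∑_{u=1}^m cos(α)^u (σ^{(u)} + σ^{(-u)})`. -/
def bMat (d : ℕ) (α : ℝ) (Sg : L2 ℤ →L[ℂ] L2 ℤ) (m : ℕ) : Matrix (Fin d) (Fin d) ℂ :=
  sigmaMat d Sg 0 + ∑ u ∈ Finset.Icc 1 m,
    (Real.cos α : ℂ) ^ u • (sigmaMat d Sg (u : ℤ) + sigmaMat d Sg (-(u : ℤ)))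

end Walkers

end

open Walkers

noncomputable section

namespace Walkers

/-! ### Canonical anticommutation relations and second quantization -/

/-! The coupling is quadratic in the modes, so the evolution acts linearly on annihilation operators
as soon as reservoir and sample modes anticommute. In the tensor product they commute. Replacing
`b_l ⊗ 1` by `b_l ⊗ (-1)^N` (`reservoirMode`) repairs this, and the unitary `klein` intertwines the
evolution built from the anticommuting modes with the given one (`stepOp_mul_klein`). In these modes
the coupling is a rotation by the angle `α` that mixes only site 0 of the sample and site 0 of the
reservoir (`rotation_conj_sampleMode`).

Over one period every sample mode passes the contact once, and a reservoir mode produced there moves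
away from it for good. Hence after `m` periods `a_j` has become `cos^m(α) a_j` plus an explicit
combination of reservoir modes (`heisenberg_sampleMode`, `emitted`).

The monomials of the reduced density matrices are even in the sample modes, so the Klein phase does
not affect them (`sampleState_eq_kleinState`). Wick's formula, extended multilinearly to `emitted`
operators (`Extends.map_eq_det`), gives determinants of their two-point function `sin²(α) M(m)`
(`two_point_emitted`). For `p = 2` the expansion has sixteen words. Gauge invariance leaves six: one
with sample operators only, one with reservoir operators only, and four mixed ones, which are the
terms of the antisymmetrized `ρ^{(1)} ⊗ M(m)` (`sampleState_monomial_two`). The recursion in `m`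
follows from this closed form by substituting `M(m+1) = cos²(α) M(m) + B(m)` (`sigmaSum_succ`).

If `|cos α| < 1`, then `B(m)` converges by comparison with a geometric series, and the affine
recursion forces `sin²(α) M(m)` to the same limit (`tendsto_sigmaSum`). The term `cos^m(α) a_j` dies
in norm, so in a word of any length each evolved mode may be replaced by its reservoir part
(`asympEq_emitted`). What remains is a minor of `sin²(α) M(m)`, whose limit is the matrix element of
the antisymmetrized tensor power (`wedge_dotProduct_tensorMat_const`). -/

theorem creation_apply {ι : Type} [LinearOrder ι] (j : ι) (f : Fock ι) (S : Finset ι) :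
    (creation j f) S = if j ∈ S then wedgeSign j (S.erase j) * f (S.erase j) else 0 := by
  rw [← inner_ket S, creation, ContinuousLinearMap.star_eq_adjoint,
    ContinuousLinearMap.adjoint_inner_right]
  have h : annihilation j (ket S)
      = if j ∈ S then wedgeSign j (S.erase j) • ket (S.erase j) else 0 := by
    ext T
    rw [annihilation_apply, ket_apply]
    by_cases hjS : j ∈ S
    · rw [if_pos hjS, lp.coeFn_smul, Pi.smul_apply, ket_apply]
      by_cases hT : T = S.erase j
      · subst hT
        simp [Finset.insert_erase hjS]
      · rw [if_neg hT]
        by_cases hjT : j ∈ T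
        · simp [hjT]
        · have : insert j T ≠ S := fun h => hT (by rw [← h, Finset.erase_insert hjT])
          simp [this]
    · have : insert j T ≠ S := fun h => hjS (h ▸ Finset.mem_insert_self j T)
      simp [hjS, this]
  rw [h]
  split_ifs
  · rw [inner_smul_left, inner_ket]
    simp [wedgeSign]
  · simp

theorem wedgeSign_mul_self {ι : Type} [LinearOrder ι] (j : ι) (S : Finset ι) :
    wedgeSign j S * wedgeSign j S = 1 := by
  rw [wedgeSign, ← mul_pow]
  simp

/-- The sign counts the elements below `j`, so a new element matters only if it lies below `j`. For
distinct `i`, `j` exactly one of `i < j` and `j < i` holds; this is the origin of every minus sign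
in the anticommutation relations. -/
theorem wedgeSign_insert {ι : Type} [LinearOrder ι] {i j : ι} {S : Finset ι} (hi : i ∉ S) :
    wedgeSign j (insert i S) = (if i < j then -1 else 1) * wedgeSign j S := by
  unfold wedgeSign
  rw [Finset.filter_insert]
  split_ifs with h
  · rw [Finset.card_insert_of_notMem (by simp [hi]), pow_succ]
    ring
  · simp

theorem annihilation_mul_annihilation {ι : Type} [LinearOrder ι] (i j : ι) :
    annihilation i * annihilation j = -(annihilation j * annihilation i) := by
  ext f S
  rw [neg_apply, lp.coeFn_neg, Pi.neg_apply, mul_apply_eq_comp, mul_apply_eq_comp]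
  simp only [annihilation_apply, Finset.mem_insert]
  by_cases hij : i = j
  · subst hij
    simp
  · have hji : j ≠ i := Ne.symm hij
    by_cases hi : i ∈ S
    · simp [hi]
    by_cases hj : j ∈ S
    · simp [hj]
    simp only [hi, hj, hij, hji, or_self, if_false, wedgeSign_insert hi, wedgeSign_insert hj,
      Finset.insert_comm i j]
    rcases lt_or_gt_of_ne hij with h | h
    · simp only [h, h.not_gt, if_true, if_false]
      ring
    · simp only [h, h.not_gt, if_true, if_false]
      ring

theorem annihilation_mul_self {ι : Type} [LinearOrder ι] (i : ι) :
    annihilation i * annihilation i = 0 := by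
  ext f S
  rw [mul_apply_eq_comp]
  simp [annihilation_apply]

theorem annihilation_mul_creation_self {ι : Type} [LinearOrder ι] (i : ι) :
    annihilation i * creation i + creation i * annihilation i = 1 := by
  ext f S
  rw [add_apply, lp.coeFn_add, Pi.add_apply, mul_apply_eq_comp, mul_apply_eq_comp,
    one_apply_eq_self]
  simp only [annihilation_apply, creation_apply]
  by_cases hi : i ∈ S
  · simp [hi, ← mul_assoc, wedgeSign_mul_self]
  · simp [hi, ← mul_assoc, wedgeSign_mul_self]

theorem annihilation_mul_creation {ι : Type} [LinearOrder ι] {i j : ι} (hij : i ≠ j) :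
    annihilation i * creation j = -(creation j * annihilation i) := by
  ext f S
  rw [neg_apply, lp.coeFn_neg, Pi.neg_apply, mul_apply_eq_comp, mul_apply_eq_comp]
  simp only [annihilation_apply, creation_apply]
  by_cases hi : i ∈ S
  · simp [hi, hij]
  by_cases hj : j ∈ S
  -- With `j` removed, both orders of the operators are expressed through signs on the common set
  -- `R`.
  · obtain ⟨R, hR, rfl⟩ : ∃ R, j ∉ R ∧ S = insert j R :=
      ⟨S.erase j, Finset.notMem_erase j S, (Finset.insert_erase hj).symm⟩
    have hiR : i ∉ R := fun h => hi (Finset.mem_insert_of_mem h)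
    have hji : j ∉ insert i R := by simp [hR, hij.symm]
    rw [Finset.insert_comm, Finset.erase_insert hji, Finset.erase_insert hR]
    simp only [Finset.mem_insert, hij, hiR, hR, or_self, or_false, true_or, if_true,
      if_false, wedgeSign_insert hiR, wedgeSign_insert hR]
    rcases lt_or_gt_of_ne hij with h | h
    · simp only [h, h.not_gt, if_true, if_false]
      ring
    · simp only [h, h.not_gt, if_true, if_false]
      ring
  · simp [hi, hj, hij.symm]

/-- The parity operator `(-1)^N`. -/
def parity (ι : Type) : Fock ι →L[ℂ] Fock ι :=
  substOp (fun S => (-1) ^ S.card) id (fun S => by simp) Function.injective_id.injOn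

theorem parity_apply {ι : Type} (f : Fock ι) (S : Finset ι) :
    (parity ι f) S = (-1) ^ S.card * f S :=
  substOp_apply _ _ _ _ f S

theorem parity_mul_self (ι : Type) : parity ι * parity ι = 1 := by
  ext f S
  rw [mul_apply_eq_comp, parity_apply, parity_apply, ← mul_assoc, ← mul_pow]
  simp

theorem star_parity (ι : Type) : star (parity ι) = parity ι := by
  ext f S
  rw [← inner_ket S, ContinuousLinearMap.star_eq_adjoint, ContinuousLinearMap.adjoint_inner_right]
  have : parity ι (ket S) = (-1 : ℂ) ^ S.card • ket S := by
    classical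
    ext T
    rw [parity_apply, lp.coeFn_smul, Pi.smul_apply, ket_apply]
    split_ifs with h
    · simp [h]
    · simp
  rw [this, inner_smul_left, inner_ket, parity_apply]
  simp

theorem parity_mul_annihilation {ι : Type} [LinearOrder ι] (j : ι) :
    parity ι * annihilation j = -(annihilation j * parity ι) := by
  ext f S
  rw [neg_apply, lp.coeFn_neg, Pi.neg_apply, mul_apply_eq_comp, mul_apply_eq_comp, parity_apply,
    annihilation_apply, annihilation_apply, parity_apply]
  split_ifs with h
  · simp
  · rw [Finset.card_insert_of_notMem h, pow_succ]
    ring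

/-! ### Second quantization of permutations -/

theorem secondQuant_apply {ι : Type} [LinearOrder ι] (f : Equiv.Perm ι) (g : Fock ι)
    (T : Finset ι) :
    (secondQuant f g) T
      = permSign f (T.map f.symm.toEmbedding) * g (T.map f.symm.toEmbedding) :=
  substOp_apply _ _ _ _ g T

theorem star_secondQuant_apply {ι : Type} [LinearOrder ι] (f : Equiv.Perm ι) (g : Fock ι)
    (T : Finset ι) :
    (star (secondQuant f) g) T = permSign f T * g (T.map f.toEmbedding) := by
  rw [← inner_ket T, ContinuousLinearMap.star_eq_adjoint,
    ContinuousLinearMap.adjoint_inner_right, secondQuant_ket, inner_smul_left, inner_ket]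
  simp [permSign]

theorem permSign_mul_self {ι : Type} [LinearOrder ι] (f : Equiv.Perm ι) (S : Finset ι) :
    permSign f S * permSign f S = 1 := by
  rw [permSign, ← mul_pow]
  simp

theorem map_symm_map {ι : Type} (f : Equiv.Perm ι) (T : Finset ι) :
    (T.map f.toEmbedding).map f.symm.toEmbedding = T := by
  ext x
  simp

theorem map_map_symm {ι : Type} (f : Equiv.Perm ι) (T : Finset ι) :
    (T.map f.symm.toEmbedding).map f.toEmbedding = T := by
  ext x
  simp

theorem star_secondQuant_mul_self {ι : Type} [LinearOrder ι] (f : Equiv.Perm ι) :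
    star (secondQuant f) * secondQuant f = 1 := by
  ext g T
  rw [mul_apply_eq_comp, star_secondQuant_apply, secondQuant_apply, map_symm_map, ← mul_assoc,
    permSign_mul_self, one_mul, one_apply_eq_self]

theorem secondQuant_mul_star_self {ι : Type} [LinearOrder ι] (f : Equiv.Perm ι) :
    secondQuant f * star (secondQuant f) = 1 := by
  ext g T
  rw [mul_apply_eq_comp, secondQuant_apply, star_secondQuant_apply, map_map_symm, ← mul_assoc,
    permSign_mul_self, one_mul, one_apply_eq_self]

theorem parity_mul_secondQuant {ι : Type} [LinearOrder ι] (f : Equiv.Perm ι) :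
    parity ι * secondQuant f = secondQuant f * parity ι := by
  ext g T
  rw [mul_apply_eq_comp, mul_apply_eq_comp, parity_apply, secondQuant_apply, secondQuant_apply,
    parity_apply, Finset.card_map]
  ring

/-- Inversions of `f` on `insert j S` that involve `j`. -/
theorem permSign_insert {ι : Type} [LinearOrder ι] (f : Equiv.Perm ι) {j : ι} {S : Finset ι}
    (hj : j ∉ S) :
    permSign f (insert j S) = permSign f S
      * ((-1) ^ (S.filter fun i => i < j ∧ f j < f i).card
        * (-1) ^ (S.filter fun i => j < i ∧ f i < f j).card) := by
  classical
  unfold permSign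
  rw [← pow_add, ← pow_add]
  congr 1
  have h : ((insert j S ×ˢ insert j S).filter fun p : ι × ι => p.1 < p.2 ∧ f p.2 < f p.1)
      = ((S ×ˢ S).filter fun p : ι × ι => p.1 < p.2 ∧ f p.2 < f p.1)
        ∪ ((S.filter fun i => i < j ∧ f j < f i).image (fun i => (i, j))
          ∪ (S.filter fun i => j < i ∧ f i < f j).image (fun i => (j, i))) := by
    ext ⟨x, y⟩
    simp only [Finset.mem_filter, Finset.mem_product, Finset.mem_insert, Finset.mem_union,
      Finset.mem_image, Prod.mk.injEq]
    constructor
    · rintro ⟨⟨rfl | hx, rfl | hy⟩, h⟩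
      · exact absurd h.1 (lt_irrefl _)
      · exact Or.inr (Or.inr ⟨y, ⟨hy, h⟩, rfl, rfl⟩)
      · exact Or.inr (Or.inl ⟨x, ⟨hx, h⟩, rfl, rfl⟩)
      · exact Or.inl ⟨⟨hx, hy⟩, h⟩
    · rintro (⟨⟨hx, hy⟩, h⟩ | ⟨i, ⟨hi, h⟩, rfl, rfl⟩ | ⟨i, ⟨hi, h⟩, rfl, rfl⟩)
      · exact ⟨⟨Or.inr hx, Or.inr hy⟩, h⟩
      · exact ⟨⟨Or.inr hi, Or.inl rfl⟩, h⟩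
      · exact ⟨⟨Or.inl rfl, Or.inr hi⟩, h⟩
  rw [h, Finset.card_union_of_disjoint, Finset.card_union_of_disjoint,
    Finset.card_image_of_injective _ (fun x y h => by simpa using h),
    Finset.card_image_of_injective _ (fun x y h => by simpa using h)]
  · rw [Finset.disjoint_left]
    simp only [Finset.mem_image, Finset.mem_filter]
    rintro _ ⟨x, ⟨hx, -⟩, rfl⟩ ⟨y, ⟨hy, -⟩, h⟩
    simp only [Prod.mk.injEq] at h
    exact hj (h.1 ▸ hx)
  · rw [Finset.disjoint_left]
    simp only [Finset.mem_union, Finset.mem_image, Finset.mem_filter, Finset.mem_product]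
    rintro ⟨x, y⟩ ⟨⟨hx, hy⟩, -⟩ (⟨z, -, h⟩ | ⟨z, -, h⟩)
    · simp only [Prod.mk.injEq] at h
      exact hj (h.2 ▸ hy)
    · simp only [Prod.mk.injEq] at h
      exact hj (h.1 ▸ hx)

/-- Sort the elements `i` of `S` by their position relative to `j` and that of `f i` relative to `f
j`. The class `i < j`, `f i < f j` occurs in both wedge signs, and the other two classes counted
there are the inversions involving `j`, so all parities match. This is the sign identity behind
`Γ(f) a_j = a_{f(j)} Γ(f)`. -/
theorem permSign_insert_mul_wedgeSign {ι : Type} [LinearOrder ι] (f : Equiv.Perm ι) {j : ι}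
    {S : Finset ι} (hj : j ∉ S) :
    permSign f (insert j S) * wedgeSign (f j) (S.map f.toEmbedding)
      = permSign f S * wedgeSign j S := by
  rw [permSign_insert f hj, mul_assoc]
  congr 1
  unfold wedgeSign
  have hne : ∀ i ∈ S, i ≠ j := fun i hi h => hj (h ▸ hi)
  have h1 : ((S.map f.toEmbedding).filter fun i => i < f j).card
      = (S.filter fun i => i < j ∧ f i < f j).card
        + (S.filter fun i => j < i ∧ f i < f j).card := by
    rw [Finset.filter_map, Finset.card_map, ← Finset.card_union_of_disjoint]
    · congr 1
      ext i
      simp only [Finset.mem_filter, Finset.mem_union, Function.comp_apply, Equiv.coe_toEmbedding]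
      constructor
      · rintro ⟨hi, h⟩
        rcases lt_or_gt_of_ne (hne i hi) with h' | h'
        · exact Or.inl ⟨hi, h', h⟩
        · exact Or.inr ⟨hi, h', h⟩
      · rintro (⟨hi, -, h⟩ | ⟨hi, -, h⟩) <;> exact ⟨hi, h⟩
    · rw [Finset.disjoint_left]
      simp only [Finset.mem_filter]
      rintro i ⟨-, h, -⟩ ⟨-, h', -⟩
      exact lt_asymm h h'
  have h2 : (S.filter fun i => i < j).card
      = (S.filter fun i => i < j ∧ f i < f j).card
        + (S.filter fun i => i < j ∧ f j < f i).card := by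
    rw [← Finset.card_union_of_disjoint]
    · congr 1
      ext i
      simp only [Finset.mem_filter, Finset.mem_union]
      constructor
      · rintro ⟨hi, h⟩
        rcases lt_or_gt_of_ne (f.injective.ne (hne i hi)) with h' | h'
        · exact Or.inl ⟨hi, h, h'⟩
        · exact Or.inr ⟨hi, h, h'⟩
      · rintro (⟨hi, h, -⟩ | ⟨hi, h, -⟩) <;> exact ⟨hi, h⟩
    · rw [Finset.disjoint_left]
      simp only [Finset.mem_filter]
      rintro i ⟨-, -, h⟩ ⟨-, -, h'⟩
      exact lt_asymm h h'
  have hs : ∀ n : ℕ, ((-1 : ℂ) ^ n) * (-1) ^ n = 1 := fun n => by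
    rw [← mul_pow]
    simp
  rw [h1, h2, pow_add, pow_add]
  linear_combination ((-1 : ℂ) ^ (S.filter fun i => i < j ∧ f j < f i).card
    * (-1) ^ (S.filter fun i => i < j ∧ f i < f j).card)
    * hs (S.filter fun i => j < i ∧ f i < f j).card

theorem secondQuant_mul_annihilation {ι : Type} [LinearOrder ι] (f : Equiv.Perm ι) (j : ι) :
    secondQuant f * annihilation j = annihilation (f j) * secondQuant f := by
  ext g T
  obtain ⟨S, rfl⟩ : ∃ S : Finset ι, T = S.map f.toEmbedding := ⟨_, (map_map_symm f T).symm⟩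
  rw [mul_apply_eq_comp, mul_apply_eq_comp, secondQuant_apply, annihilation_apply,
    annihilation_apply, secondQuant_apply, map_symm_map]
  have h1 : (insert (f j) (S.map f.toEmbedding)).map f.symm.toEmbedding = insert j S := by
    rw [Finset.map_insert, map_symm_map]
    simp
  have h2 : f j ∈ S.map f.toEmbedding ↔ j ∈ S := by simp
  rw [h1]
  by_cases hj : j ∈ S
  · simp [hj]
  · rw [if_neg hj, if_neg (fun h => hj (h2.1 h)), ← mul_assoc, ← mul_assoc,
      mul_comm (wedgeSign (f j) _), permSign_insert_mul_wedgeSign f hj]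

theorem star_secondQuant_mul_annihilation_mul {ι : Type} [LinearOrder ι] (f : Equiv.Perm ι)
    (j : ι) :
    star (secondQuant f) * annihilation (f j) * secondQuant f = annihilation j := by
  rw [mul_assoc, ← secondQuant_mul_annihilation, ← mul_assoc, star_secondQuant_mul_self, one_mul]

/-! ### The projection onto antisymmetric tensors -/

theorem wedge_apply {p d : ℕ} (j : Fin p → Fin d) (x : Fin p → Fin d) :
    wedge j x = (1 / (Real.sqrt p.factorial : ℂ)) *
      ∑ π : Equiv.Perm (Fin p), ((π.sign : ℤ) : ℂ) * if x = j ∘ π then 1 else 0 := by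
  simp only [wedge, Pi.smul_apply, Finset.sum_apply, smul_eq_mul, Pi.single_apply]

theorem star_wedge {p d : ℕ} (j : Fin p → Fin d) : star (wedge j) = wedge j := by
  ext x
  rw [Pi.star_apply, wedge_apply, star_mul', star_sum, ← starRingEnd_apply, map_div₀,
    Complex.conj_ofReal, map_one]
  congr 1
  refine Finset.sum_congr rfl fun π _ => ?_
  rw [star_mul']
  congr 1
  · rw [← starRingEnd_apply, map_intCast]
  · split_ifs <;> simp

theorem antisymProj_apply {p d : ℕ} (x y : Fin p → Fin d) :
    antisymProj p d x y = (1 / (p.factorial : ℂ)) *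
      ∑ π : Equiv.Perm (Fin p), ((π.sign : ℤ) : ℂ) * if x = y ∘ π then 1 else 0 := by
  simp [antisymProj, Matrix.sum_apply, permTensor]

theorem inv_sqrt_factorial_mul_self (p : ℕ) :
    (1 / (Real.sqrt p.factorial : ℂ)) * (1 / (Real.sqrt p.factorial : ℂ))
      = 1 / (p.factorial : ℂ) := by
  rw [div_mul_div_comm, one_mul, ← Complex.ofReal_mul, Real.mul_self_sqrt (Nat.cast_nonneg _),
    Complex.ofReal_natCast]

/-- If two entries of `y` agree, composing `π` with their transposition leaves `y ∘ π` unchanged and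
flips the sign, so the terms cancel in pairs. -/
theorem antisymProj_apply_of_not_injective {p d : ℕ} {x y : Fin p → Fin d}
    (hy : ¬ Function.Injective y) : antisymProj p d x y = 0 := by
  obtain ⟨a, b, hab, hne⟩ : ∃ a b, y a = y b ∧ a ≠ b := by
    simpa [Function.Injective] using hy
  rw [antisymProj_apply]
  have h : ∑ π : Equiv.Perm (Fin p), ((π.sign : ℤ) : ℂ) * (if x = y ∘ π then 1 else 0) = 0 := by
    have hy' : ∀ π : Equiv.Perm (Fin p), y ∘ (Equiv.swap a b * π : Equiv.Perm (Fin p)) = y ∘ π := by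
      intro π
      ext1 i
      simp only [Function.comp_apply, Equiv.Perm.mul_apply, Equiv.swap_apply_def]
      split_ifs with h1 h2
      · rw [h1, hab]
      · rw [h2, hab]
      · rfl
    refine Finset.sum_ninvolution (fun π => Equiv.swap a b * π) (fun π => ?_) (fun π _ => ?_)
      (fun π => Finset.mem_univ _) (fun π => ?_)
    · rw [hy']
      rw [Equiv.Perm.sign_mul, Equiv.Perm.sign_swap hne]
      push_cast
      ring
    · rw [Ne, mul_eq_right, Equiv.swap_eq_one_iff]
      exact hne
    · rw [← mul_assoc, Equiv.swap_mul_self, one_mul]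
  rw [h, mul_zero]

theorem wedge_apply_of_not_injective {p d : ℕ} (j : Fin p ↪o Fin d) {y : Fin p → Fin d}
    (hy : ¬ Function.Injective y) : wedge j y = 0 := by
  rw [wedge_apply, Finset.sum_eq_zero, mul_zero]
  intro π _
  rw [if_neg, mul_zero]
  rintro rfl
  exact hy (j.injective.comp π.injective)

/-- An increasing family is determined by its range. -/
theorem orderEmbedding_comp_perm_injective {p d : ℕ} {j j' : Fin p ↪o Fin d}
    {π π' : Equiv.Perm (Fin p)} (h : j ∘ π = j' ∘ π') : j = j' ∧ π = π' := by
  have hr : Set.range j = Set.range j' := by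
    rw [← π.surjective.range_comp j, h, π'.surjective.range_comp]
  have hj : j = j' := by
    apply DFunLike.coe_injective
    exact (StrictMono.range_inj j.strictMono j'.strictMono).1 hr
  subst hj
  refine ⟨rfl, Equiv.ext fun i => j.injective (congrFun h i)⟩

theorem wedge_apply_comp {p d : ℕ} (j j' : Fin p ↪o Fin d) (π : Equiv.Perm (Fin p)) :
    wedge j (j' ∘ π)
      = if j = j' then (1 / (Real.sqrt p.factorial : ℂ)) * ((π.sign : ℤ) : ℂ) else 0 := by
  rw [wedge_apply]
  split_ifs with h
  · subst h
    rw [Finset.sum_eq_single π]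
    · simp
    · intro π' _ hπ
      rw [if_neg, mul_zero]
      exact fun h => hπ (orderEmbedding_comp_perm_injective h).2.symm
    · simp
  · rw [Finset.sum_eq_zero, mul_zero]
    intro π' _
    rw [if_neg, mul_zero]
    exact fun h' => h (orderEmbedding_comp_perm_injective h').1.symm

theorem exists_orderEmbedding_comp_perm {p d : ℕ} {y : Fin p → Fin d}
    (hy : Function.Injective y) : ∃ (j : Fin p ↪o Fin d) (π : Equiv.Perm (Fin p)), y = j ∘ π := by
  have hm : StrictMono (y ∘ Tuple.sort y) :=
    (Tuple.monotone_sort y).strictMono_of_injective (hy.comp (Tuple.sort y).injective)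
  refine ⟨OrderEmbedding.ofStrictMono _ hm, (Tuple.sort y)⁻¹, ?_⟩
  ext1 i
  simp

/-- The wedges of increasing families are an orthonormal basis of the antisymmetric tensors. In a
column with injective index `j ∘ σ` only the term of `j` survives; in every other column both sides
vanish. -/
theorem antisymProj_eq_sum (p d : ℕ) :
    antisymProj p d
      = ∑ j : Fin p ↪o Fin d, Matrix.vecMulVec (wedge j) (star (wedge j)) := by
  ext x y
  rw [Matrix.sum_apply]
  simp only [Matrix.vecMulVec_apply, star_wedge]
  by_cases hy : Function.Injective y
  · obtain ⟨j, σ, rfl⟩ := exists_orderEmbedding_comp_perm hy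
    simp only [wedge_apply_comp]
    rw [Finset.sum_eq_single j (fun b _ hb => by rw [if_neg hb, mul_zero]) (by simp), if_pos rfl,
      antisymProj_apply, wedge_apply, ← inv_sqrt_factorial_mul_self]
    have h : ∑ π : Equiv.Perm (Fin p), ((π.sign : ℤ) : ℂ) * (if x = (j ∘ σ) ∘ π then 1 else 0)
        = (∑ π : Equiv.Perm (Fin p), ((π.sign : ℤ) : ℂ) * if x = j ∘ π then 1 else 0)
          * ((σ.sign : ℤ) : ℂ) := by
      conv_rhs => rw [Finset.sum_mul, ← Equiv.sum_comp (Equiv.mulLeft σ)]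
      refine Finset.sum_congr rfl fun π _ => ?_
      have h1 : ((σ.sign : ℤ) : ℂ) * ((σ.sign : ℤ) : ℂ) = 1 := by
        rw [← Int.cast_mul, ← Units.val_mul, Int.units_mul_self]
        simp
      rw [Equiv.coe_mulLeft, Equiv.Perm.sign_mul, Equiv.Perm.coe_mul, Function.comp_assoc,
        Units.val_mul, Int.cast_mul]
      linear_combination (-((π.sign : ℤ) : ℂ) * if x = j ∘ σ ∘ π then 1 else 0) * h1
    rw [h]
    ring
  · rw [antisymProj_apply_of_not_injective hy, Finset.sum_eq_zero]
    intro j _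
    rw [wedge_apply_of_not_injective j hy, mul_zero]

/-- This is an expansion of the same shape as `reducedDM`, so identities and limits of reduced
density matrices can be checked coefficient by coefficient. -/
theorem antisymProj_mul_mul_antisymProj {p d : ℕ} (X : TensorOp p d) :
    antisymProj p d * X * antisymProj p d
      = ∑ j : Fin p ↪o Fin d, ∑ k : Fin p ↪o Fin d,
        (star (wedge j) ⬝ᵥ X.mulVec (wedge k)) • Matrix.vecMulVec (wedge j) (star (wedge k)) := by
  rw [antisymProj_eq_sum, Finset.sum_mul, Finset.sum_mul]
  refine Finset.sum_congr rfl fun j _ => ?_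
  rw [Finset.mul_sum]
  refine Finset.sum_congr rfl fun k _ => ?_
  rw [Matrix.vecMulVec_mul, Matrix.vecMulVec_mul_vecMulVec, ← Matrix.dotProduct_mulVec]
  ext x y
  simp only [Matrix.vecMulVec_apply, Matrix.smul_apply, Pi.smul_apply, smul_eq_mul]
  ring

theorem wedge_dotProduct_tensorMat_mulVec {p d : ℕ} (A : Fin p → Matrix (Fin d) (Fin d) ℂ)
    (j k : Fin p → Fin d) :
    star (wedge j) ⬝ᵥ (tensorMat A).mulVec (wedge k)
      = (1 / (p.factorial : ℂ)) * ∑ π : Equiv.Perm (Fin p), ∑ π' : Equiv.Perm (Fin p),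
        ((π.sign : ℤ) : ℂ) * ((π'.sign : ℤ) : ℂ) * ∏ i, A i (j (π i)) (k (π' i)) := by
  rw [star_wedge, wedge, wedge, Matrix.mulVec_smul, smul_dotProduct, dotProduct_smul, smul_eq_mul,
    smul_eq_mul, ← mul_assoc, inv_sqrt_factorial_mul_self, sum_dotProduct]
  congr 1
  refine Finset.sum_congr rfl fun π _ => ?_
  rw [Matrix.mulVec_sum, dotProduct_sum]
  refine Finset.sum_congr rfl fun π' _ => ?_
  rw [Matrix.mulVec_smul, smul_dotProduct, dotProduct_smul, single_dotProduct, one_mul,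
    Matrix.mulVec_single_one, smul_eq_mul, smul_eq_mul, mul_assoc]
  rfl

/-- With equal factors the double sum over permutations depends only on the relative permutation.
Each of the `p!` inner sums is therefore the same determinant, and this cancels the normalization.
-/
theorem wedge_dotProduct_tensorMat_const {p d : ℕ} (R : Matrix (Fin d) (Fin d) ℂ)
    (j k : Fin p → Fin d) :
    star (wedge j) ⬝ᵥ (tensorMat fun _ => R).mulVec (wedge k) = (R.submatrix j k).det := by
  rw [wedge_dotProduct_tensorMat_mulVec]
  have h : ∀ π : Equiv.Perm (Fin p), ∑ π' : Equiv.Perm (Fin p),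
      ((π.sign : ℤ) : ℂ) * ((π'.sign : ℤ) : ℂ) * ∏ i, R (j (π i)) (k (π' i))
        = (R.submatrix j k).det := by
    intro π
    rw [← Matrix.det_transpose, Matrix.det_apply', ← Equiv.sum_comp (Equiv.mulRight π)]
    refine Finset.sum_congr rfl fun π' _ => ?_
    have h1 : ((π.sign : ℤ) : ℂ) * ((π.sign : ℤ) : ℂ) = 1 := by
      rw [← Int.cast_mul, ← Units.val_mul, Int.units_mul_self]
      simp
    have h2 : ∏ i, R (j (π i)) (k ((π' * π) i)) = ∏ i, R (j i) (k (π' i)) :=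
      Equiv.prod_comp π fun i => R (j i) (k (π' i))
    rw [Equiv.coe_mulRight, h2, Equiv.Perm.sign_mul, Units.val_mul, Int.cast_mul]
    simp only [Matrix.transpose_apply, Matrix.submatrix_apply]
    linear_combination (((π'.sign : ℤ) : ℂ) * ∏ i, R (j i) (k (π' i))) * h1
  rw [Finset.sum_congr rfl fun π _ => h π, Finset.sum_const, Finset.card_univ, Fintype.card_perm,
    Fintype.card_fin, nsmul_eq_mul, ← mul_assoc, one_div, inv_mul_cancel₀, one_mul]
  exact_mod_cast p.factorial_ne_zero

theorem wedge_dotProduct_tensorMat_two {d : ℕ} (A B : Matrix (Fin d) (Fin d) ℂ)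
    (j k : Fin 2 → Fin d) :
    star (wedge j) ⬝ᵥ (tensorMat ![A, B]).mulVec (wedge k)
      = (A (j 0) (k 0) * B (j 1) (k 1) + A (j 1) (k 1) * B (j 0) (k 0)
        - A (j 0) (k 1) * B (j 1) (k 0) - A (j 1) (k 0) * B (j 0) (k 1)) / 2 := by
  have hu : (Finset.univ : Finset (Equiv.Perm (Fin 2))) = {1, Equiv.swap 0 1} := by decide
  have hne : (1 : Equiv.Perm (Fin 2)) ≠ Equiv.swap 0 1 := by decide
  rw [wedge_dotProduct_tensorMat_mulVec, hu]
  simp only [Finset.sum_pair hne, Fin.prod_univ_two, Equiv.Perm.sign_one,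
    Equiv.Perm.sign_swap (show (0 : Fin 2) ≠ 1 by decide), Equiv.Perm.one_apply,
    Equiv.swap_apply_left, Equiv.swap_apply_right, Matrix.cons_val_zero, Matrix.cons_val_one]
  simp
  ring

theorem antisymProj_tensorMat_comm {d : ℕ} (A B : Matrix (Fin d) (Fin d) ℂ) :
    antisymProj 2 d * tensorMat ![A, B] * antisymProj 2 d
      = antisymProj 2 d * tensorMat ![B, A] * antisymProj 2 d := by
  rw [antisymProj_mul_mul_antisymProj, antisymProj_mul_mul_antisymProj]
  refine Finset.sum_congr rfl fun j _ => Finset.sum_congr rfl fun k _ => ?_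
  rw [wedge_dotProduct_tensorMat_two, wedge_dotProduct_tensorMat_two]
  congr 1
  ring

/-! ### The algebra of operators `A ⊗ B` -/

theorem sum_inner_ket_smul_ket {κ : Type} [Fintype κ] (v : L2 κ) :
    ∑ x, ⟪ket x, v⟫_ℂ • ket x = v := by
  classical
  ext x
  rw [lp.coeFn_sum, Finset.sum_apply]
  simp [ket_apply, inner_ket]

theorem sum_inner_ket_mul_inner_ket {κ : Type} [Fintype κ] (A B : L2 κ →L[ℂ] L2 κ) (x y : κ) :
    ∑ z, ⟪ket x, A (ket z)⟫_ℂ * ⟪ket z, B (ket y)⟫_ℂ = ⟪ket x, (A * B) (ket y)⟫_ℂ := by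
  rw [mul_apply_eq_comp]
  conv_rhs => rw [← sum_inner_ket_smul_ket (B (ket y))]
  rw [map_sum, inner_sum]
  refine Finset.sum_congr rfl fun z _ => ?_
  rw [map_smul, inner_smul_right, mul_comm]

theorem ext_block {d : ℕ} {X Y : Composite d →L[ℂ] Composite d}
    (h : ∀ T T', block X T T' = block Y T T') : X = Y := by
  refine ContinuousLinearMap.ext fun x => ?_
  rw [← sum_incl_compo x, map_sum, map_sum]
  refine Finset.sum_congr rfl fun T' _ => ?_
  rw [← sum_incl_compo (X _), ← sum_incl_compo (Y _)]
  refine Finset.sum_congr rfl fun T _ => congrArg (incl T) ?_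
  exact DFunLike.congr_fun (h T T') (compo T' x)

theorem block_add {d : ℕ} (X Y : Composite d →L[ℂ] Composite d) (T T' : Finset (Fin d)) :
    block (X + Y) T T' = block X T T' + block Y T T' := by
  ext1 ψ
  simp [block]

theorem block_smul {d : ℕ} (c : ℂ) (X : Composite d →L[ℂ] Composite d) (T T' : Finset (Fin d)) :
    block (c • X) T T' = c • block X T T' := by
  ext1 ψ
  simp [block]

theorem tens_mul_tens {d : ℕ} (A A' : Fock ℤ →L[ℂ] Fock ℤ)
    (B B' : Fock (Fin d) →L[ℂ] Fock (Fin d)) :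
    tens A B * tens A' B' = tens (A * A') (B * B') := by
  refine ext_block fun T T' => ?_
  simp only [block_mul, block_tens, smul_mul_assoc, mul_smul_comm, smul_smul]
  rw [← sum_inner_ket_mul_inner_ket, Finset.sum_smul]
  exact Finset.sum_congr rfl fun L _ => by rw [mul_comm]

theorem star_tens {d : ℕ} (A : Fock ℤ →L[ℂ] Fock ℤ) (B : Fock (Fin d) →L[ℂ] Fock (Fin d)) :
    star (tens A B) = tens (star A) (star B) := by
  refine ext_block fun T T' => ?_
  rw [block_star, block_tens, block_tens, star_smul, ContinuousLinearMap.star_eq_adjoint B,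
    ContinuousLinearMap.adjoint_inner_right, ← inner_conj_symm, starRingEnd_apply, star_star]

theorem tens_one_one (d : ℕ) : tens (d := d) 1 1 = 1 := by
  classical
  refine ext_block fun T T' => ?_
  rw [block_tens, block_one, one_apply_eq_self, inner_ket, ket_apply]
  split_ifs <;> simp

theorem tens_add_left {d : ℕ} (A A' : Fock ℤ →L[ℂ] Fock ℤ)
    (B : Fock (Fin d) →L[ℂ] Fock (Fin d)) : tens (A + A') B = tens A B + tens A' B := by
  refine ext_block fun T T' => ?_
  simp only [block_add, block_tens, smul_add]

theorem tens_add_right {d : ℕ} (A : Fock ℤ →L[ℂ] Fock ℤ)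
    (B B' : Fock (Fin d) →L[ℂ] Fock (Fin d)) : tens A (B + B') = tens A B + tens A B' := by
  refine ext_block fun T T' => ?_
  simp only [block_add, block_tens, add_apply, inner_add_right, add_smul]

theorem tens_smul_left {d : ℕ} (c : ℂ) (A : Fock ℤ →L[ℂ] Fock ℤ)
    (B : Fock (Fin d) →L[ℂ] Fock (Fin d)) : tens (c • A) B = c • tens A B := by
  refine ext_block fun T T' => ?_
  simp only [block_smul, block_tens, smul_comm c]

theorem tens_smul_right {d : ℕ} (c : ℂ) (A : Fock ℤ →L[ℂ] Fock ℤ)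
    (B : Fock (Fin d) →L[ℂ] Fock (Fin d)) : tens A (c • B) = c • tens A B := by
  refine ext_block fun T T' => ?_
  simp only [block_smul, block_tens, smul_apply, inner_smul_right, smul_smul]

/-- The C*-algebra of operators on the composite system. -/
def CompOp (d : ℕ) : Type := Composite d →L[ℂ] Composite d

instance (d : ℕ) : CStarAlgebra (CompOp d) :=
  inferInstanceAs (CStarAlgebra (Composite d →L[ℂ] Composite d))

/-- `A ⊗ B` as an element of the C*-algebra of operators on the composite system. -/
def tensOp {d : ℕ} (A : Fock ℤ →L[ℂ] Fock ℤ) (B : Fock (Fin d) →L[ℂ] Fock (Fin d)) : CompOp d :=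
  tens A B

theorem tensOp_mul_tensOp {d : ℕ} (A A' : Fock ℤ →L[ℂ] Fock ℤ)
    (B B' : Fock (Fin d) →L[ℂ] Fock (Fin d)) :
    tensOp A B * tensOp A' B' = tensOp (A * A') (B * B') := tens_mul_tens A A' B B'

theorem star_tensOp {d : ℕ} (A : Fock ℤ →L[ℂ] Fock ℤ) (B : Fock (Fin d) →L[ℂ] Fock (Fin d)) :
    star (tensOp A B) = tensOp (star A) (star B) := star_tens A B

theorem tensOp_one_one (d : ℕ) : tensOp (d := d) 1 1 = 1 := tens_one_one d

theorem tensOp_add_left {d : ℕ} (A A' : Fock ℤ →L[ℂ] Fock ℤ)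
    (B : Fock (Fin d) →L[ℂ] Fock (Fin d)) : tensOp (A + A') B = tensOp A B + tensOp A' B :=
  tens_add_left A A' B

theorem tensOp_add_right {d : ℕ} (A : Fock ℤ →L[ℂ] Fock ℤ)
    (B B' : Fock (Fin d) →L[ℂ] Fock (Fin d)) : tensOp A (B + B') = tensOp A B + tensOp A B' :=
  tens_add_right A B B'

theorem tensOp_smul_left {d : ℕ} (c : ℂ) (A : Fock ℤ →L[ℂ] Fock ℤ)
    (B : Fock (Fin d) →L[ℂ] Fock (Fin d)) : tensOp (c • A) B = c • tensOp A B :=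
  tens_smul_left c A B

theorem tensOp_smul_right {d : ℕ} (c : ℂ) (A : Fock ℤ →L[ℂ] Fock ℤ)
    (B : Fock (Fin d) →L[ℂ] Fock (Fin d)) : tensOp A (c • B) = c • tensOp A B :=
  tens_smul_right c A B

theorem tensOp_neg_right {d : ℕ} (A : Fock ℤ →L[ℂ] Fock ℤ)
    (B : Fock (Fin d) →L[ℂ] Fock (Fin d)) : tensOp A (-B) = -tensOp A B := by
  rw [← neg_one_smul ℂ B, tensOp_smul_right, neg_one_smul]

theorem tensOp_neg_left {d : ℕ} (A : Fock ℤ →L[ℂ] Fock ℤ)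
    (B : Fock (Fin d) →L[ℂ] Fock (Fin d)) : tensOp (-A) B = -tensOp A B := by
  rw [← neg_one_smul ℂ A, tensOp_smul_left, neg_one_smul]

theorem tensOp_zero_left {d : ℕ} (B : Fock (Fin d) →L[ℂ] Fock (Fin d)) : tensOp 0 B = 0 := by
  rw [← zero_smul ℂ (0 : Fock ℤ →L[ℂ] Fock ℤ), tensOp_smul_left, zero_smul]

theorem tensOp_sum_left {d : ℕ} {κ : Type} (s : Finset κ) (A : κ → Fock ℤ →L[ℂ] Fock ℤ)
    (B : Fock (Fin d) →L[ℂ] Fock (Fin d)) : tensOp (∑ i ∈ s, A i) B = ∑ i ∈ s, tensOp (A i) B := by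
  classical
  induction s using Finset.induction_on with
  | empty => simp [tensOp_zero_left]
  | insert i s hi ih => rw [Finset.sum_insert hi, Finset.sum_insert hi, tensOp_add_left, ih]

/-! ### Klein transformation -/

/-- The two sign changes cancel. Hence each quadratic term of `generator` commutes with every mode
not at the contact. -/
theorem commute_mul_of_anticommute {R : Type*} [Ring R] {p q x : R} (hp : p * x = -(x * p))
    (hq : q * x = -(x * q)) : Commute (p * q) x := by
  rw [Commute, SemiconjBy, mul_assoc, hq, mul_neg, ← mul_assoc, hp, neg_mul, neg_neg, mul_assoc]

/-- `1 ⊗ a_j`. -/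
def sampleMode {d : ℕ} (j : Fin d) : CompOp d := tensOp 1 (annihilation j)

/-- `b_l ⊗ (-1)^N`, which anticommutes with the `1 ⊗ a_j` and `1 ⊗ a_j^*`. -/
def reservoirMode (d : ℕ) (l : ℤ) : CompOp d :=
  tensOp (annihilation l) (parity (Fin d))

theorem sampleMode_mul_sampleMode {d : ℕ} (i j : Fin d) :
    sampleMode i * sampleMode j = -(sampleMode j * sampleMode i) := by
  simp only [sampleMode, tensOp_mul_tensOp]
  rw [annihilation_mul_annihilation, tensOp_neg_right]

theorem sampleMode_mul_self {d : ℕ} (i : Fin d) : sampleMode i * sampleMode i = 0 := by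
  rw [sampleMode, tensOp_mul_tensOp, annihilation_mul_self, ← zero_smul ℂ
    (0 : Fock (Fin d) →L[ℂ] Fock (Fin d)), tensOp_smul_right, zero_smul]

theorem star_sampleMode {d : ℕ} (i : Fin d) : star (sampleMode i) = tensOp 1 (creation i) := by
  rw [sampleMode, star_tensOp, star_one, creation]

theorem sampleMode_mul_star_self {d : ℕ} (i : Fin d) :
    sampleMode i * star (sampleMode i) + star (sampleMode i) * sampleMode i = 1 := by
  rw [star_sampleMode, sampleMode, tensOp_mul_tensOp, tensOp_mul_tensOp, ← tensOp_add_right,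
    annihilation_mul_creation_self, mul_one, tensOp_one_one]

theorem star_sampleMode_mul_sampleMode {d : ℕ} {i j : Fin d} (hij : i ≠ j) :
    star (sampleMode i) * sampleMode j = -(sampleMode j * star (sampleMode i)) := by
  rw [star_sampleMode, sampleMode, tensOp_mul_tensOp, tensOp_mul_tensOp,
    annihilation_mul_creation hij.symm, tensOp_neg_right, neg_neg]

theorem star_reservoirMode (d : ℕ) (l : ℤ) :
    star (reservoirMode d l) = tensOp (creation l) (parity (Fin d)) := by
  rw [reservoirMode, star_tensOp, star_parity, creation]

theorem reservoirMode_mul_reservoirMode (d : ℕ) (k l : ℤ) :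
    reservoirMode d k * reservoirMode d l = -(reservoirMode d l * reservoirMode d k) := by
  simp only [reservoirMode, tensOp_mul_tensOp]
  rw [annihilation_mul_annihilation, tensOp_neg_left]

theorem reservoirMode_mul_self (d : ℕ) (l : ℤ) : reservoirMode d l * reservoirMode d l = 0 := by
  rw [reservoirMode, tensOp_mul_tensOp, annihilation_mul_self, tensOp_zero_left]

theorem reservoirMode_mul_star_self (d : ℕ) (l : ℤ) :
    reservoirMode d l * star (reservoirMode d l)
      + star (reservoirMode d l) * reservoirMode d l = 1 := by
  rw [star_reservoirMode, reservoirMode, tensOp_mul_tensOp, tensOp_mul_tensOp, ← tensOp_add_left,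
    annihilation_mul_creation_self, parity_mul_self, tensOp_one_one]

theorem star_reservoirMode_mul_reservoirMode {d : ℕ} {k l : ℤ} (hkl : k ≠ l) :
    star (reservoirMode d k) * reservoirMode d l
      = -(reservoirMode d l * star (reservoirMode d k)) := by
  rw [star_reservoirMode, reservoirMode, tensOp_mul_tensOp, tensOp_mul_tensOp,
    annihilation_mul_creation hkl.symm, tensOp_neg_left, neg_neg]

theorem reservoirMode_mul_sampleMode {d : ℕ} (l : ℤ) (j : Fin d) :
    reservoirMode d l * sampleMode j = -(sampleMode j * reservoirMode d l) := by
  rw [reservoirMode, sampleMode, tensOp_mul_tensOp, tensOp_mul_tensOp, mul_one, one_mul,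
    parity_mul_annihilation, tensOp_neg_right]

theorem star_reservoirMode_mul_sampleMode {d : ℕ} (l : ℤ) (j : Fin d) :
    star (reservoirMode d l) * sampleMode j = -(sampleMode j * star (reservoirMode d l)) := by
  rw [star_reservoirMode, sampleMode, tensOp_mul_tensOp, tensOp_mul_tensOp, mul_one, one_mul,
    parity_mul_annihilation, tensOp_neg_right]

theorem star_sampleMode_mul_reservoirMode {d : ℕ} (l : ℤ) (j : Fin d) :
    star (sampleMode j) * reservoirMode d l = -(reservoirMode d l * star (sampleMode j)) := by
  have := congrArg star (star_reservoirMode_mul_sampleMode l j)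
  rwa [star_mul, star_star, star_neg, star_mul, star_star] at this

/-- The quadratic generator `b_0^* a_0 - a_0^* b_0` of the anticommuting modes. -/
def generator (d : ℕ) [NeZero d] : CompOp d :=
  star (reservoirMode d 0) * sampleMode 0 - star (sampleMode 0) * reservoirMode d 0

theorem star_generator (d : ℕ) [NeZero d] : star (generator d) = -generator d := by
  rw [generator, star_sub, star_mul, star_mul, star_star, star_star, neg_sub]

theorem commute_generator_sampleMode {d : ℕ} [NeZero d] {j : Fin d} (hj : j ≠ 0) :
    Commute (generator d) (sampleMode j) :=
  (commute_mul_of_anticommute (star_reservoirMode_mul_sampleMode 0 j)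
    (sampleMode_mul_sampleMode 0 j)).sub_left
  (commute_mul_of_anticommute (star_sampleMode_mul_sampleMode hj.symm)
    (reservoirMode_mul_sampleMode 0 j))

theorem commute_generator_reservoirMode {d : ℕ} [NeZero d] {l : ℤ} (hl : l ≠ 0) :
    Commute (generator d) (reservoirMode d l) :=
  (commute_mul_of_anticommute (star_reservoirMode_mul_reservoirMode hl.symm)
    (by rw [reservoirMode_mul_sampleMode, neg_neg])).sub_left
  (commute_mul_of_anticommute (star_sampleMode_mul_reservoirMode l 0)
    (reservoirMode_mul_reservoirMode d 0 l))

/-- The term containing `a_0` contributes nothing to the commutator, since `a_0² = 0`; in the other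
term `a_0 a_0^* + a_0^* a_0 = 1` leaves the reservoir mode. Together with
`generator_mul_reservoirMode`, the commutator with the generator acts on the two contact modes as an
infinitesimal rotation. -/
theorem generator_mul_sampleMode (d : ℕ) [NeZero d] :
    generator d * sampleMode 0 = sampleMode 0 * generator d + reservoirMode d 0 := by
  have h1 := sampleMode_mul_self (0 : Fin d)
  have h2 : sampleMode 0 * star (reservoirMode d 0)
      = -(star (reservoirMode d 0) * sampleMode 0) := by
    rw [star_reservoirMode_mul_sampleMode, neg_neg]
  have h3 := reservoirMode_mul_sampleMode (d := d) 0 0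
  have h4 : sampleMode 0 * star (sampleMode 0) = 1 - star (sampleMode 0) * sampleMode (0 : Fin d) :=
    eq_sub_of_add_eq (sampleMode_mul_star_self 0)
  rw [generator, sub_mul, mul_sub, mul_assoc, mul_assoc, h1, h3, ← mul_assoc, ← mul_assoc, h2, h4,
    neg_mul, mul_assoc, h1, sub_mul, one_mul, mul_assoc]
  simp

theorem generator_mul_reservoirMode (d : ℕ) [NeZero d] :
    generator d * reservoirMode d 0 = reservoirMode d 0 * generator d - sampleMode 0 := by
  have h1 := reservoirMode_mul_self d 0
  have h2 : reservoirMode d 0 * star (sampleMode 0)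
      = -(star (sampleMode 0) * reservoirMode d 0) := by
    rw [star_sampleMode_mul_reservoirMode, neg_neg]
  have h3 : sampleMode 0 * reservoirMode d 0 = -(reservoirMode d 0 * sampleMode (0 : Fin d)) := by
    rw [reservoirMode_mul_sampleMode, neg_neg]
  have h4 : reservoirMode d 0 * star (reservoirMode d 0)
      = 1 - star (reservoirMode d 0) * reservoirMode d 0 :=
    eq_sub_of_add_eq (reservoirMode_mul_star_self d 0)
  rw [generator, sub_mul, mul_sub, mul_assoc, mul_assoc, h1, h3, ← mul_assoc, ← mul_assoc, h2, h4,
    neg_mul, mul_assoc, h1, sub_mul, one_mul, mul_assoc]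
  simp

/-! ### The coupling as a rotation of the two contact modes -/

/-- A one-parameter group acts on an eigenvector of `[G, ·]` by an exponential factor. -/
theorem exp_neg_mul_mul_exp_of_eigen {R : Type*} [NormedRing R] [NormedAlgebra ℂ R]
    [CompleteSpace R] {G X : R} {μ : ℂ} (h : G * X = X * (G - μ • 1)) (t : ℂ) :
    NormedSpace.exp (-(t • G)) * X * NormedSpace.exp (t • G) = Complex.exp (t * μ) • X := by
  let := NormedAlgebra.restrictScalars ℚ ℂ R
  -- The hypothesis says that `X` intertwines `t • G - (t * μ) • 1` with `t • G`. The exponentials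
  -- are then intertwined too, and the central part `(t * μ) • 1` comes out as a scalar.
  have hs : SemiconjBy X (t • G - (t * μ) • (1 : R)) (t • G) := by
    rw [SemiconjBy, smul_mul_assoc, h, mul_smul, ← smul_sub, mul_smul_comm]
  have h1 := hs.exp_neg_mul_mul_exp_eq_self
  have h2 : NormedSpace.exp (t • G)
      = NormedSpace.exp (t • G - (t * μ) • (1 : R)) * algebraMap ℂ R (Complex.exp (t * μ)) := by
    have h3 : NormedSpace.exp ((t * μ) • (1 : R)) = algebraMap ℂ R (Complex.exp (t * μ)) := by
      rw [← Algebra.algebraMap_eq_smul_one, Complex.exp_eq_exp_ℂ]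
      exact (NormedSpace.algebraMap_exp_comm (t * μ)).symm
    rw [← h3, ← NormedSpace.exp_add_of_commute, sub_add_cancel]
    exact (Commute.one_right _).smul_right _
  rw [h2, ← mul_assoc, h1, ← Algebra.commutes, ← Algebra.smul_def]

/-- The coupling in terms of the anticommuting modes. -/
def rotation (d : ℕ) [NeZero d] (α : ℝ) : CompOp d :=
  NormedSpace.exp ((α : ℂ) • generator d)

theorem star_rotation (d : ℕ) [NeZero d] (α : ℝ) :
    star (rotation d α) = NormedSpace.exp (-((α : ℂ) • generator d)) := by
  rw [rotation, NormedSpace.star_exp, star_smul, star_generator, smul_neg]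
  congr 3
  exact Complex.conj_ofReal α

theorem star_rotation_mul_self (d : ℕ) [NeZero d] (α : ℝ) :
    star (rotation d α) * rotation d α = 1 := by
  let := NormedAlgebra.restrictScalars ℚ ℂ (CompOp d)
  rw [star_rotation, rotation, ← NormedSpace.exp_add_of_commute (Commute.refl _).neg_left,
    neg_add_cancel, NormedSpace.exp_zero]

theorem rotation_mul_star_self (d : ℕ) [NeZero d] (α : ℝ) :
    rotation d α * star (rotation d α) = 1 := by
  let := NormedAlgebra.restrictScalars ℚ ℂ (CompOp d)
  rw [star_rotation, rotation, ← NormedSpace.exp_add_of_commute (Commute.refl _).neg_right,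
    add_neg_cancel, NormedSpace.exp_zero]

theorem rotation_conj_of_commute {d : ℕ} [NeZero d] (α : ℝ) {X : CompOp d}
    (h : Commute (generator d) X) : star (rotation d α) * X * rotation d α = X := by
  let := NormedAlgebra.restrictScalars ℚ ℂ (CompOp d)
  have h1 : Commute (rotation d α) X := (h.smul_left (α : ℂ)).exp_left
  rw [mul_assoc, ← h1.eq, ← mul_assoc, star_rotation_mul_self, one_mul]

/-- The combinations of `a_0` and the reservoir mode with coefficients `1` and `± i` are
eigenvectors of the commutator with the generator and acquire the factors `exp(± iα)`. Their average
is `a_0`, and Euler's formula gives the cosine and the sine. -/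
theorem rotation_conj_sampleMode (d : ℕ) [NeZero d] (α : ℝ) :
    star (rotation d α) * sampleMode 0 * rotation d α
      = (Real.cos α : ℂ) • sampleMode 0 - (Real.sin α : ℂ) • reservoirMode d 0 := by
  have key : ∀ μ : ℂ, μ * μ = -1 →
      star (rotation d α) * (sampleMode 0 + μ • reservoirMode d 0) * rotation d α
        = Complex.exp (α * μ) • (sampleMode 0 + μ • reservoirMode d 0) := by
    intro μ hμ
    rw [star_rotation]
    refine exp_neg_mul_mul_exp_of_eigen ?_ _
    rw [mul_add, mul_smul_comm, generator_mul_sampleMode, generator_mul_reservoirMode, mul_sub,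
      add_mul, mul_smul_comm, mul_one, smul_add, smul_smul, hμ, smul_mul_assoc]
    module
  have h1 := key Complex.I Complex.I_mul_I
  have h2 := key (-Complex.I) (by simp)
  have h3 : sampleMode (0 : Fin d) = (2⁻¹ : ℂ) • (sampleMode 0 + Complex.I • reservoirMode d 0)
      + (2⁻¹ : ℂ) • (sampleMode 0 + (-Complex.I) • reservoirMode d 0) := by
    module
  conv_lhs => rw [h3]
  rw [mul_add, add_mul, mul_smul_comm, mul_smul_comm, smul_mul_assoc, smul_mul_assoc, h1, h2,
    mul_neg, Complex.exp_mul_I, ← neg_mul, Complex.exp_mul_I, Complex.cos_neg, Complex.sin_neg,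
    Complex.ofReal_cos, Complex.ofReal_sin]
  match_scalars
  · ring
  · linear_combination Complex.sin α * Complex.I_mul_I

/-! ### Unitary equivalence with the given evolution -/

/-- `freeOp` as an element of the C*-algebra of operators on the composite system. -/
def freeOp (d : ℕ) [NeZero d] : CompOp d :=
  tensOp (secondQuant shiftInt) (secondQuant (shiftSample d))

/-- The evolution in terms of the anticommuting modes. -/
def kleinStep (d : ℕ) [NeZero d] (α : ℝ) : CompOp d :=
  freeOp d * rotation d α

/-- `1` on even and `i` on odd numbers of sample particles. -/
def kleinPhase (d : ℕ) : Fock (Fin d) →L[ℂ] Fock (Fin d) :=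
  ((1 + Complex.I) / 2) • 1 + ((1 - Complex.I) / 2) • parity (Fin d)

theorem star_kleinPhase (d : ℕ) : star (kleinPhase d)
    = ((1 - Complex.I) / 2) • 1 + ((1 + Complex.I) / 2) • parity (Fin d) := by
  rw [kleinPhase, star_add, star_smul, star_smul, star_parity, star_one]
  simp [sub_eq_add_neg]

theorem kleinPhase_mul_star_self (d : ℕ) : kleinPhase d * star (kleinPhase d) = 1 := by
  rw [star_kleinPhase, kleinPhase]
  simp only [add_mul, mul_add, smul_mul_assoc, mul_smul_comm, one_mul, mul_one, parity_mul_self]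
  match_scalars
  · linear_combination (-1 / 2 : ℂ) * Complex.I_mul_I
  · linear_combination (1 / 2 : ℂ) * Complex.I_mul_I

theorem star_kleinPhase_mul_self (d : ℕ) : star (kleinPhase d) * kleinPhase d = 1 := by
  rw [star_kleinPhase, kleinPhase]
  simp only [add_mul, mul_add, smul_mul_assoc, mul_smul_comm, one_mul, mul_one, parity_mul_self]
  match_scalars
  · linear_combination (-1 / 2 : ℂ) * Complex.I_mul_I
  · linear_combination (1 / 2 : ℂ) * Complex.I_mul_I

theorem parity_mul_creation {ι : Type} [LinearOrder ι] (j : ι) :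
    parity ι * creation j = -(creation j * parity ι) := by
  have := congrArg star (parity_mul_annihilation j)
  rw [star_mul, star_neg, star_mul, star_parity] at this
  rw [creation, this, neg_neg]

/-- Annihilation switches the parity of the particle number. Going from odd to even the phase
changes by `-i` and the parity is `1`; from even to odd the phase changes by `i` and the parity is
`-1`. The product is `-i` in both cases. -/
theorem kleinPhase_mul_annihilation {d : ℕ} (j : Fin d) :
    kleinPhase d * (parity (Fin d) * annihilation j)
      = (-Complex.I) • (annihilation j * kleinPhase d) := by
  rw [kleinPhase]
  simp only [add_mul, mul_add, smul_mul_assoc, mul_smul_comm, one_mul, mul_one]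
  rw [← mul_assoc, parity_mul_self, one_mul, parity_mul_annihilation]
  match_scalars
  · linear_combination (-1 / 2 : ℂ) * Complex.I_mul_I
  · linear_combination (1 / 2 : ℂ) * Complex.I_mul_I

theorem kleinPhase_mul_creation {d : ℕ} (j : Fin d) :
    kleinPhase d * (creation j * parity (Fin d))
      = Complex.I • (creation j * kleinPhase d) := by
  rw [kleinPhase]
  simp only [add_mul, mul_add, smul_mul_assoc, mul_smul_comm, one_mul, mul_one]
  rw [← mul_assoc, parity_mul_creation, neg_mul, mul_assoc, parity_mul_self, mul_one]
  match_scalars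
  · linear_combination (1 / 2 : ℂ) * Complex.I_mul_I
  · linear_combination (-1 / 2 : ℂ) * Complex.I_mul_I

/-- `1 ⊗ v` with `v` the operator `kleinPhase`. -/
def klein (d : ℕ) : CompOp d := tensOp 1 (kleinPhase d)

theorem klein_mul_star_self (d : ℕ) : klein d * star (klein d) = 1 := by
  rw [klein, star_tensOp, tensOp_mul_tensOp, kleinPhase_mul_star_self, star_one, one_mul, tensOp_one_one]

/-- The annihilation term of the generator picks up `-i` and the creation term `i`. The relative
minus sign in the generator makes both coefficients `-i`, which turns the antihermitian difference
into `-i` times the hermitian coupling. -/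
theorem klein_mul_generator (d : ℕ) [NeZero d] :
    klein d * generator d = ((-Complex.I) • (tensOp (creation (0 : ℤ)) (annihilation (0 : Fin d))
      + tensOp (annihilation (0 : ℤ)) (creation (0 : Fin d)))) * klein d := by
  rw [generator, star_reservoirMode, star_sampleMode, sampleMode, reservoirMode, klein,
    tensOp_mul_tensOp, tensOp_mul_tensOp, mul_sub, tensOp_mul_tensOp, tensOp_mul_tensOp, smul_mul_assoc, add_mul,
    tensOp_mul_tensOp, tensOp_mul_tensOp, kleinPhase_mul_annihilation, kleinPhase_mul_creation,
    tensOp_smul_right, tensOp_smul_right]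
  simp only [one_mul, mul_one]
  module

theorem klein_mul_freeOp (d : ℕ) [NeZero d] : klein d * freeOp d = freeOp d * klein d := by
  rw [klein, freeOp, tensOp_mul_tensOp, tensOp_mul_tensOp, one_mul, mul_one, kleinPhase]
  simp only [add_mul, mul_add, smul_mul_assoc, mul_smul_comm, one_mul, mul_one,
    parity_mul_secondQuant]

/-- `step` as an element of the C*-algebra of operators on the composite system. -/
def stepOp (d : ℕ) [NeZero d] (α : ℝ) : CompOp d := step d α

/-- The phase depends only on the parity of the particle number, so it commutes with the free step;
the coupling is handled by exponentiating `klein_mul_generator`. All later computations can thus be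
made with anticommuting modes. -/
theorem stepOp_mul_klein (d : ℕ) [NeZero d] (α : ℝ) :
    stepOp d α * klein d = klein d * kleinStep d α := by
  let := NormedAlgebra.restrictScalars ℚ ℂ (CompOp d)
  have h : SemiconjBy (klein d) ((α : ℂ) • generator d)
      ((-Complex.I * (α : ℂ)) • (tensOp (creation (0 : ℤ)) (annihilation (0 : Fin d))
        + tensOp (annihilation (0 : ℤ)) (creation (0 : Fin d)))) := by
    rw [SemiconjBy, mul_smul_comm, klein_mul_generator, mul_comm (-Complex.I), mul_smul,
      smul_mul_assoc, smul_mul_assoc, smul_mul_assoc]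
  have hs : stepOp d α = freeOp d * NormedSpace.exp ((-Complex.I * (α : ℂ)) •
      (tensOp (creation (0 : ℤ)) (annihilation (0 : Fin d))
        + tensOp (annihilation (0 : ℤ)) (creation (0 : Fin d)))) := rfl
  rw [hs, kleinStep, mul_assoc, ← mul_assoc (klein d), klein_mul_freeOp, mul_assoc]
  congr 1
  exact h.exp_right.eq.symm

theorem stepOp_pow (d : ℕ) [NeZero d] (α : ℝ) (t : ℕ) :
    stepOp d α ^ t = klein d * kleinStep d α ^ t * star (klein d) := by
  have h : SemiconjBy (klein d) (kleinStep d α) (stepOp d α) := (stepOp_mul_klein d α).symm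
  rw [(h.pow_right t).eq, mul_assoc, klein_mul_star_self, mul_one]

/-! ### Evolution of the modes -/

theorem star_freeOp_mul_self (d : ℕ) [NeZero d] : star (freeOp d) * freeOp d = 1 := by
  rw [freeOp, star_tensOp, tensOp_mul_tensOp, star_secondQuant_mul_self, star_secondQuant_mul_self,
    tensOp_one_one]

theorem freeOp_mul_star_self (d : ℕ) [NeZero d] : freeOp d * star (freeOp d) = 1 := by
  rw [freeOp, star_tensOp, tensOp_mul_tensOp, secondQuant_mul_star_self, secondQuant_mul_star_self,
    tensOp_one_one]

theorem kleinStep_mul_star_self (d : ℕ) [NeZero d] (α : ℝ) :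
    kleinStep d α * star (kleinStep d α) = 1 := by
  rw [kleinStep, star_mul, mul_assoc, ← mul_assoc (rotation d α), rotation_mul_star_self, one_mul,
    freeOp_mul_star_self]

theorem star_kleinStep_mul_self (d : ℕ) [NeZero d] (α : ℝ) :
    star (kleinStep d α) * kleinStep d α = 1 := by
  rw [kleinStep, star_mul, mul_assoc, ← mul_assoc (star (freeOp d)), star_freeOp_mul_self,
    one_mul, star_rotation_mul_self]

theorem freeOp_conj_sampleMode {d : ℕ} [NeZero d] (j : Fin d) :
    star (freeOp d) * sampleMode j * freeOp d = sampleMode (j + 1) := by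
  have : j = shiftSample d (j + 1) := by simp [shiftSample]
  rw [sampleMode, freeOp, star_tensOp, tensOp_mul_tensOp, tensOp_mul_tensOp, mul_one,
    star_secondQuant_mul_self]
  conv_lhs => rw [this]
  rw [star_secondQuant_mul_annihilation_mul, sampleMode]

theorem freeOp_conj_reservoirMode (d : ℕ) [NeZero d] (l : ℤ) :
    star (freeOp d) * reservoirMode d l * freeOp d = reservoirMode d (l + 1) := by
  rw [reservoirMode, freeOp, star_tensOp, tensOp_mul_tensOp, tensOp_mul_tensOp, conj_annihilation,
    mul_assoc _ (parity _), parity_mul_secondQuant, ← mul_assoc, star_secondQuant_mul_self,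
    one_mul, reservoirMode]

/-- The Heisenberg evolution over `t` steps in terms of the anticommuting modes. -/
def heisenberg (d : ℕ) [NeZero d] (α : ℝ) (t : ℕ) :
    (CompOp d) →ₗ[ℂ] (CompOp d) where
  toFun X := star (kleinStep d α ^ t) * X * kleinStep d α ^ t
  map_add' X Y := by rw [mul_add, add_mul]
  map_smul' c X := by rw [mul_smul_comm, smul_mul_assoc, RingHom.id_apply]

theorem heisenberg_apply (d : ℕ) [NeZero d] (α : ℝ) (t : ℕ) (X : CompOp d) :
    heisenberg d α t X = star (kleinStep d α ^ t) * X * kleinStep d α ^ t := rfl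

theorem heisenberg_add (d : ℕ) [NeZero d] (α : ℝ) (s t : ℕ)
    (X : CompOp d) :
    heisenberg d α (s + t) X = heisenberg d α t (heisenberg d α s X) := by
  simp only [heisenberg_apply, pow_add, star_mul, mul_assoc]

theorem heisenberg_zero (d : ℕ) [NeZero d] (α : ℝ) (X : CompOp d) :
    heisenberg d α 0 X = X := by
  simp [heisenberg_apply]

theorem heisenberg_one (d : ℕ) [NeZero d] (α : ℝ) (X : CompOp d) :
    heisenberg d α 1 X
      = star (rotation d α) * (star (freeOp d) * X * freeOp d) * rotation d α := by
  simp only [heisenberg_apply, pow_one, kleinStep, star_mul, mul_assoc]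

theorem kleinStep_pow_mul_star_self (d : ℕ) [NeZero d] (α : ℝ) (t : ℕ) :
    kleinStep d α ^ t * star (kleinStep d α ^ t) = 1 := by
  rw [star_pow]
  induction t with
  | zero => simp
  | succ t ih =>
    rw [pow_succ, pow_succ', mul_assoc, ← mul_assoc (kleinStep d α), kleinStep_mul_star_self,
      one_mul, ih]

theorem star_kleinStep_pow_mul_self (d : ℕ) [NeZero d] (α : ℝ) (t : ℕ) :
    star (kleinStep d α ^ t) * kleinStep d α ^ t = 1 := by
  rw [star_pow]
  induction t with
  | zero => simp
  | succ t ih =>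
    rw [pow_succ, pow_succ', mul_assoc, ← mul_assoc (star (kleinStep d α)),
      star_kleinStep_mul_self, one_mul, ih]

theorem heisenberg_mul (d : ℕ) [NeZero d] (α : ℝ) (t : ℕ) (X Y : CompOp d) :
    heisenberg d α t (X * Y) = heisenberg d α t X * heisenberg d α t Y := by
  simp only [heisenberg_apply]
  rw [mul_assoc (star _ * X), ← mul_assoc (kleinStep d α ^ t), ← mul_assoc (kleinStep d α ^ t),
    kleinStep_pow_mul_star_self, one_mul]
  simp only [mul_assoc]

theorem heisenberg_map_one (d : ℕ) [NeZero d] (α : ℝ) (t : ℕ) : heisenberg d α t 1 = 1 := by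
  rw [heisenberg_apply, mul_one, star_kleinStep_pow_mul_self]

theorem heisenberg_star (d : ℕ) [NeZero d] (α : ℝ) (t : ℕ) (X : CompOp d) :
    heisenberg d α t (star X) = star (heisenberg d α t X) := by
  simp only [heisenberg_apply, star_mul, star_star, mul_assoc]

theorem heisenberg_list_prod (d : ℕ) [NeZero d] (α : ℝ) (t : ℕ)
    (L : List (CompOp d)) :
    heisenberg d α t L.prod = (L.map (heisenberg d α t)).prod := by
  induction L with
  | nil => simp [heisenberg_map_one]
  | cons X L ih => simp [heisenberg_mul, ih]

theorem heisenberg_one_sampleMode {d : ℕ} [NeZero d] (α : ℝ) {j : Fin d} (hj : j + 1 ≠ 0) :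
    heisenberg d α 1 (sampleMode j) = sampleMode (j + 1) := by
  rw [heisenberg_one, freeOp_conj_sampleMode,
    rotation_conj_of_commute α (commute_generator_sampleMode hj)]

theorem heisenberg_one_sampleMode_last {d : ℕ} [NeZero d] (α : ℝ) {j : Fin d} (hj : j + 1 = 0) :
    heisenberg d α 1 (sampleMode j)
      = (Real.cos α : ℂ) • sampleMode 0 - (Real.sin α : ℂ) • reservoirMode d 0 := by
  rw [heisenberg_one, freeOp_conj_sampleMode, hj, rotation_conj_sampleMode]

/-- A step first moves the index from `l ≥ 0` to `l + 1 ≥ 1` and only then applies the coupling,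
which sees the reservoir mode 0 alone. Such a mode never meets the sample again. -/
theorem heisenberg_reservoirMode {d : ℕ} [NeZero d] (α : ℝ) (t : ℕ) {l : ℤ} (hl : 0 ≤ l) :
    heisenberg d α t (reservoirMode d l) = reservoirMode d (l + t) := by
  induction t with
  | zero => simp [heisenberg_zero]
  | succ t ih =>
    rw [heisenberg_add, ih, heisenberg_one, freeOp_conj_reservoirMode,
      rotation_conj_of_commute α (commute_generator_reservoirMode (by omega))]
    congr 1
    push_cast
    ring

theorem heisenberg_sampleMode_lt {d : ℕ} [NeZero d] (α : ℝ) (t j : ℕ) (h : j + t < d) :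
    heisenberg d α t (sampleMode (⟨j, by omega⟩ : Fin d)) = sampleMode ⟨j + t, h⟩ := by
  induction t with
  | zero => simp [heisenberg_zero]
  | succ t ih =>
    have h1 : (⟨j + t, by omega⟩ : Fin d) + 1 = ⟨j + (t + 1), h⟩ := by
      apply Fin.ext
      rw [Fin.val_add, Fin.val_one', Nat.add_mod_mod]
      exact Nat.mod_eq_of_lt h
    rw [heisenberg_add, ih (by omega), heisenberg_one_sampleMode α, h1]
    rw [h1, Ne, Fin.ext_iff]
    simp

/-- Over one period, each mode of the sample meets the reservoir once. -/
theorem heisenberg_sampleMode_period {d : ℕ} [NeZero d] (α : ℝ) (j : Fin d) :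
    heisenberg d α d (sampleMode j)
      = (Real.cos α : ℂ) • sampleMode j - (Real.sin α : ℂ) • reservoirMode d j := by
  obtain ⟨j, hj⟩ := j
  -- The period splits into free transport from `j` to the last site `d - 1`, the one step that
  -- wraps to site 0 and meets the coupling, and `j` free steps back to `j`.
  have hd : d = (d - 1 - j) + 1 + j := by omega
  have h1 : (⟨j + (d - 1 - j), by omega⟩ : Fin d) + 1 = 0 := by
    apply Fin.ext
    rw [Fin.val_add, Fin.val_one', Nat.add_mod_mod]
    simp only [Fin.val_zero]
    rw [show j + (d - 1 - j) + 1 = d by omega, Nat.mod_self]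
  have h0 := heisenberg_sampleMode_lt (d := d) α j 0 (by omega)
  have h2 : heisenberg d α d (sampleMode ⟨j, hj⟩)
      = heisenberg d α ((d - 1 - j) + 1 + j) (sampleMode ⟨j, hj⟩) := by rw [← hd]
  rw [h2, heisenberg_add, heisenberg_add, heisenberg_sampleMode_lt α _ j (by omega),
    heisenberg_one_sampleMode_last α h1, map_sub, map_smul, map_smul,
    heisenberg_reservoirMode α _ le_rfl]
  have h3 : (⟨0, by omega⟩ : Fin d) = 0 := rfl
  rw [h3] at h0
  rw [h0]
  simp

/-- The reservoir part of the evolved annihilation operator of the mode `j`. -/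
def emitted {d : ℕ} (α : ℝ) (m : ℕ) (j : Fin d) : Fock ℤ →L[ℂ] Fock ℤ :=
  ∑ r ∈ Finset.range m, (-(Real.sin α : ℂ) * (Real.cos α : ℂ) ^ (m - 1 - r)) •
    annihilation ((r : ℤ) * d + j)

theorem tensOp_emitted {d : ℕ} (α : ℝ) (m : ℕ) (j : Fin d) :
    tensOp (emitted α m j) (parity (Fin d))
      = ∑ r ∈ Finset.range m, (-(Real.sin α : ℂ) * (Real.cos α : ℂ) ^ (m - 1 - r)) •
        reservoirMode d ((r : ℤ) * d + j) := by
  rw [emitted, tensOp_sum_left]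
  simp only [tensOp_smul_left, reservoirMode]

/-- One more period translates the reservoir modes already present by `d` sites and adds a new one
at site `j`, with coefficient `-sin(α) cos^m(α)`. -/
theorem heisenberg_sampleMode {d : ℕ} [NeZero d] (α : ℝ) (m : ℕ) (j : Fin d) :
    heisenberg d α (m * d) (sampleMode j)
      = (Real.cos α : ℂ) ^ m • sampleMode j + tensOp (emitted α m j) (parity (Fin d)) := by
  induction m with
  | zero => simp [heisenberg_zero, emitted, tensOp_zero_left]
  | succ m ih =>
    -- The sum is split at its first index: the old terms move from `r` to `r + 1`, and `r = 0` is
    -- the new one.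
    rw [Nat.succ_mul, heisenberg_add, ih, map_add, map_smul, heisenberg_sampleMode_period,
      tensOp_emitted, tensOp_emitted, map_sum, Finset.sum_range_succ']
    have h : ∀ r ∈ Finset.range m,
        heisenberg d α d ((-(Real.sin α : ℂ) * (Real.cos α : ℂ) ^ (m - 1 - r)) •
          reservoirMode d ((r : ℤ) * d + j))
        = (-(Real.sin α : ℂ) * (Real.cos α : ℂ) ^ (m + 1 - 1 - (r + 1))) •
          reservoirMode d (((r + 1 : ℕ) : ℤ) * d + j) := by
      intro r hr
      rw [map_smul, heisenberg_reservoirMode α d (by positivity)]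
      congr 2
      · congr 1
        omega
      · push_cast
        ring
    rw [Finset.sum_congr rfl h]
    simp only [Nat.add_sub_cancel, Nat.sub_zero, Nat.cast_zero, zero_mul, zero_add]
    module

/-! ### Quasi-free states on linear combinations of annihilation operators -/

/-- Multilinear maps that agree on a set agree on its span. -/
theorem multilinearMap_eq_of_mem_span {ι E F : Type*} [Finite ι] [AddCommGroup E] [Module ℂ E]
    [AddCommGroup F] [Module ℂ F] (f g : MultilinearMap ℂ (fun _ : ι => E) F) (S : ι → Set E)
    (h : ∀ x : ι → E, (∀ i, x i ∈ S i) → f x = g x) (x : ι → E)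
    (hx : ∀ i, x i ∈ Submodule.span ℂ (S i)) : f x = g x := by
  classical
  have := Fintype.ofFinite ι
  -- Induction on the set of slots that may range over the span, the others being kept among the
  -- generators. Each new slot is treated by linearity in that slot.
  have key : ∀ (s : Finset ι) (x : ι → E), (∀ i ∈ s, x i ∈ Submodule.span ℂ (S i)) →
      (∀ i ∉ s, x i ∈ S i) → f x = g x := by
    intro s
    induction s using Finset.induction_on with
    | empty => exact fun x _ hx => h x fun i => hx i (Finset.notMem_empty i)
    | insert a s ha ih =>
      intro x h1 h2
      have h3 : ∀ e ∈ Submodule.span ℂ (S a),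
          f (Function.update x a e) = g (Function.update x a e) := by
        intro e he
        induction he using Submodule.span_induction with
        | mem e he =>
          refine ih _ (fun i hi => ?_) (fun i hi => ?_)
          · rw [Function.update_of_ne (ne_of_mem_of_not_mem hi ha)]
            exact h1 i (Finset.mem_insert_of_mem hi)
          · by_cases hia : i = a
            · subst hia
              rwa [Function.update_self]
            · rw [Function.update_of_ne hia]
              exact h2 i (by simp [hia, hi])
        | zero => rw [f.map_update_zero, g.map_update_zero]
        | add u v _ _ hu hv => rw [f.map_update_add, g.map_update_add, hu, hv]
        | smul c u _ hu => rw [f.map_update_smul, g.map_update_smul, hu]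
      have := h3 (x a) (h1 a (Finset.mem_insert_self a s))
      rwa [Function.update_eq_self] at this
  exact key Finset.univ x (fun i _ => hx i) (fun i hi => absurd (Finset.mem_univ i) hi)

theorem reverse_ofFn {n : ℕ} {α : Type*} (f : Fin n → α) :
    (List.ofFn f).reverse = List.ofFn (f ∘ Fin.rev) := by
  refine List.ext_getElem (by simp) fun i h1 h2 => ?_
  simp only [List.getElem_reverse, List.getElem_ofFn, List.length_ofFn, Function.comp_apply]
  congr 1
  apply Fin.ext
  simp [Fin.val_rev]
  omega

/-- The product of a family in decreasing order, as a multilinear map. -/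
def revProd (R : Type*) [Ring R] [Algebra ℂ R] (n : ℕ) : MultilinearMap ℂ (fun _ : Fin n => R) R :=
  (MultilinearMap.mkPiAlgebraFin ℂ n R).domDomCongr Fin.revPerm

theorem revProd_apply {R : Type*} [Ring R] [Algebra ℂ R] {n : ℕ} (x : Fin n → R) :
    revProd R n x = (List.ofFn x).reverse.prod := by
  rw [reverse_ofFn, revProd, MultilinearMap.domDomCongr_apply, MultilinearMap.mkPiAlgebraFin_apply]
  rfl

/-- The span of the annihilation operators. -/
def annihilationSpan (ι : Type) [LinearOrder ι] : Submodule ℂ (Fock ι →L[ℂ] Fock ι) :=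
  Submodule.span ℂ (Set.range annihilation)

/-- The span of the creation operators. -/
def creationSpan (ι : Type) [LinearOrder ι] : Submodule ℂ (Fock ι →L[ℂ] Fock ι) :=
  Submodule.span ℂ (Set.range creation)

theorem star_mem_creationSpan {ι : Type} [LinearOrder ι] {x : Fock ι →L[ℂ] Fock ι}
    (hx : x ∈ annihilationSpan ι) : star x ∈ creationSpan ι := by
  induction hx using Submodule.span_induction with
  | mem x hx =>
    obtain ⟨j, rfl⟩ := hx
    exact Submodule.subset_span ⟨j, rfl⟩
  | zero => rw [star_zero]; exact zero_mem _
  | add u v _ _ hu hv => rw [star_add]; exact add_mem hu hv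
  | smul c u _ hu => rw [star_smul]; exact Submodule.smul_mem _ _ hu

/-- A bounded functional on all operators that extends `ω`. -/
def Extends (g : (Fock ℤ →L[ℂ] Fock ℤ) →L[ℂ] ℂ) (ω : reservoirAlgebra →L[ℂ] ℂ) : Prop :=
  ∀ x : reservoirAlgebra, g x.1 = ω x

/-- By Hahn–Banach. With a functional on all operators, linear combinations and products can be
evaluated without carrying proofs of membership in the reservoir algebra; of the extension only
linearity, continuity and agreement with `ω` are used. -/
theorem exists_extends (ω : reservoirAlgebra →L[ℂ] ℂ) :
    ∃ g : (Fock ℤ →L[ℂ] Fock ℤ) →L[ℂ] ℂ, Extends g ω := by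
  obtain ⟨g, hg, -⟩ := exists_extension_norm_eq
    (Subalgebra.toSubmodule reservoirAlgebra.toSubalgebra) ω
  exact ⟨g, hg⟩

theorem coe_list_prod_ofFn {n : ℕ} (x : Fin n → reservoirAlgebra) :
    ((List.ofFn x).prod : reservoirAlgebra).1 = (List.ofFn fun i => (x i).1).prod := by
  have := map_list_prod reservoirAlgebra.subtype (List.ofFn x)
  rw [List.map_ofFn] at this
  exact this

section Quasifree

variable {Sg : L2 ℤ →L[ℂ] L2 ℤ} {ω : reservoirAlgebra →L[ℂ] ℂ}
  {g : (Fock ℤ →L[ℂ] Fock ℤ) →L[ℂ] ℂ}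

theorem Extends.map_one (hg : Extends g ω) (hω : IsQuasiFreeState Sg ω) : g 1 = 1 :=
  (hg 1).trans hω.map_one

/-- The quasi-free formula lists creators in decreasing and annihilators in increasing order, the
monomials do the opposite. Reversing both families reconciles the conventions. -/
theorem Extends.map_word (hg : Extends g ω) {m n : ℕ} (φ : Fin m → ℤ) (ψ : Fin n → ℤ) :
    g ((List.ofFn fun i => creation (φ i)).prod
        * (List.ofFn fun i => annihilation (ψ i)).reverse.prod)
      = ω ((List.ofFn fun i => star (b (φ (Fin.rev i)))).reverse.prod
        * (List.ofFn fun i => b (ψ (Fin.rev i))).prod) := by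
  rw [← hg, reverse_ofFn, reverse_ofFn]
  congr 1
  rw [MulMemClass.coe_mul, coe_list_prod_ofFn, coe_list_prod_ofFn]
  simp only [Function.comp_def, Fin.rev_rev]
  rfl

theorem Extends.map_creation_mul_annihilation (hg : Extends g ω) (hω : IsQuasiFreeState Sg ω)
    (k j : ℤ) : g (creation k * annihilation j) = ⟪ket j, Sg (ket k)⟫_ℂ := by
  have h := hg.map_word (fun _ : Fin 1 => k) (fun _ : Fin 1 => j)
  rw [hω.map_of_eq] at h
  simpa using h

/-- Wick's formula for linear combinations of creation and annihilation operators. -/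
theorem Extends.map_eq_det (hg : Extends g ω) (hω : IsQuasiFreeState Sg ω) {n : ℕ}
    {x y : Fin n → Fock ℤ →L[ℂ] Fock ℤ} (hx : ∀ i, x i ∈ creationSpan ℤ)
    (hy : ∀ i, y i ∈ annihilationSpan ℤ) :
    g ((List.ofFn x).prod * (List.ofFn y).reverse.prod)
      = (Matrix.of fun j k => g (x k * y j)).det := by
  have h1 : ∀ φ ψ : Fin n → ℤ, g ((List.ofFn fun i => creation (φ i)).prod
        * (List.ofFn fun i => annihilation (ψ i)).reverse.prod)
      = (Matrix.of fun j k => g (creation (φ k) * annihilation (ψ j))).det := by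
    intro φ ψ
    rw [hg.map_word, hω.map_of_eq]
    simp only [hg.map_creation_mul_annihilation hω]
    exact Matrix.det_submatrix_equiv_self Fin.revPerm
      (Matrix.of fun j k => ⟪ket (ψ j), Sg (ket (φ k))⟫_ℂ)
  -- The annihilation slots are extended first. They index the rows of the determinant, so with the
  -- creators fixed both sides are multilinear in them.
  have h2 : ∀ φ : Fin n → ℤ, g ((List.ofFn fun i => creation (φ i)).prod
        * (List.ofFn y).reverse.prod)
      = (Matrix.of fun j k => g (creation (φ k) * y j)).det := by
    intro φ
    have := multilinearMap_eq_of_mem_span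
      ((g.toLinearMap ∘ₗ LinearMap.mulLeft ℂ (List.ofFn fun i => creation (φ i)).prod
        ).compMultilinearMap (revProd _ n))
      ((Matrix.detRowAlternating (R := ℂ) (n := Fin n)).toMultilinearMap.compLinearMap
        fun _ => LinearMap.pi fun k => g.toLinearMap ∘ₗ LinearMap.mulLeft ℂ (creation (φ k)))
      (fun _ => Set.range annihilation) (fun x hx => ?_) y hy
    · simpa [revProd_apply] using! this
    · choose ψ hψ using hx
      obtain rfl : (fun i => annihilation (ψ i)) = x := funext hψ
      have := h1 φ ψ
      simpa [revProd_apply] using! this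
  -- The creation slots index the columns, so the transpose is used to make the determinant
  -- multilinear in them.
  have h3 := multilinearMap_eq_of_mem_span
      ((g.toLinearMap ∘ₗ LinearMap.mulRight ℂ (List.ofFn y).reverse.prod
        ).compMultilinearMap (MultilinearMap.mkPiAlgebraFin ℂ n (Fock ℤ →L[ℂ] Fock ℤ)))
      ((Matrix.detRowAlternating (R := ℂ) (n := Fin n)).toMultilinearMap.compLinearMap
        fun _ => LinearMap.pi fun j => g.toLinearMap ∘ₗ LinearMap.mulRight ℂ (y j))
      (fun _ => Set.range creation) (fun x hx => ?_) x hx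
  · have h4 : g ((List.ofFn x).prod * (List.ofFn y).reverse.prod)
        = Matrix.detRowAlternating fun i k => g (x i * y k) := by
      simpa using! h3
    exact h4.trans (Matrix.det_transpose (Matrix.of fun j k => g (x k * y j)))
  · choose φ hφ using hx
    obtain rfl : (fun i => creation (φ i)) = x := funext hφ
    have := (h2 φ).trans
      (Matrix.det_transpose (Matrix.of fun j k => g (creation (φ k) * y j))).symm
    have h4 : g ((List.ofFn fun i => creation (φ i)).prod * (List.ofFn y).reverse.prod)
        = Matrix.detRowAlternating fun i k => g (creation (φ i) * y k) := this
    simpa using! h4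

/-- Gauge invariance, extended from basis modes to linear combinations by the same multilinearity.
It kills every word with unequal numbers of emitted creators and annihilators. -/
theorem Extends.map_eq_zero (hg : Extends g ω) (hω : IsQuasiFreeState Sg ω) {m n : ℕ}
    (hmn : m ≠ n) {x : Fin m → Fock ℤ →L[ℂ] Fock ℤ} {y : Fin n → Fock ℤ →L[ℂ] Fock ℤ}
    (hx : ∀ i, x i ∈ creationSpan ℤ) (hy : ∀ i, y i ∈ annihilationSpan ℤ) :
    g ((List.ofFn x).prod * (List.ofFn y).reverse.prod) = 0 := by
  have h2 : ∀ φ : Fin m → ℤ, g ((List.ofFn fun i => creation (φ i)).prod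
        * (List.ofFn y).reverse.prod) = 0 := by
    intro φ
    have := multilinearMap_eq_of_mem_span
      ((g.toLinearMap ∘ₗ LinearMap.mulLeft ℂ (List.ofFn fun i => creation (φ i)).prod
        ).compMultilinearMap (revProd _ n)) 0
      (fun _ => Set.range annihilation) (fun x hx => ?_) y hy
    · simpa [revProd_apply] using this
    · choose ψ hψ using hx
      obtain rfl : (fun i => annihilation (ψ i)) = x := funext hψ
      have := (hg.map_word φ ψ).trans (hω.map_of_ne _ _ _ _ hmn)
      simpa [revProd_apply] using this
  have h3 := multilinearMap_eq_of_mem_span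
      ((g.toLinearMap ∘ₗ LinearMap.mulRight ℂ (List.ofFn y).reverse.prod
        ).compMultilinearMap (MultilinearMap.mkPiAlgebraFin ℂ m (Fock ℤ →L[ℂ] Fock ℤ))) 0
      (fun _ => Set.range creation) (fun x hx => ?_) x hx
  · simpa using h3
  · choose φ hφ using hx
    obtain rfl : (fun i => creation (φ i)) = x := funext hφ
    have := h2 φ
    simpa using this

/-! ### The state of the composite system -/

/-- The block `⟨e_T, X e_{T'}⟩`, linear and continuous in `X`. -/
def blockCLM {d : ℕ} (T T' : Finset (Fin d)) : CompOp d →L[ℂ] (Fock ℤ →L[ℂ] Fock ℤ) where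
  toFun X := block X T T'
  map_add' X Y := block_add X Y T T'
  map_smul' c X := block_smul c X T T'
  cont := by
    have : Continuous fun X : Composite d →L[ℂ] Composite d => block X T T' := by
      unfold block
      fun_prop
    exact this

/-- The product functional `g ⊗ ρ`, seen through the Klein transformation. -/
def kleinState {d : ℕ} (g : (Fock ℤ →L[ℂ] Fock ℤ) →L[ℂ] ℂ)
    (ρ : Fock (Fin d) →L[ℂ] Fock (Fin d)) : CompOp d →L[ℂ] ℂ :=
  (∑ T, ∑ T', ⟪ket T', ρ (ket T)⟫_ℂ • (g ∘L blockCLM T T'))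
    ∘L ContinuousLinearMap.mulLeftRight ℂ (CompOp d) (klein d) (star (klein d))

theorem kleinState_apply {d : ℕ} (g : (Fock ℤ →L[ℂ] Fock ℤ) →L[ℂ] ℂ)
    (ρ : Fock (Fin d) →L[ℂ] Fock (Fin d)) (X : CompOp d) :
    kleinState g ρ X = ∑ T, ∑ T', ⟪ket T', ρ (ket T)⟫_ℂ
      * g (block (klein d * X * star (klein d) : CompOp d) T T') := by
  simp only [kleinState, ContinuousLinearMap.comp_apply, sum_apply, smul_apply, smul_eq_mul,
    ContinuousLinearMap.mulLeftRight_apply]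
  rfl

theorem sampleTrace_mul {d : ℕ} (ρ A : Fock (Fin d) →L[ℂ] Fock (Fin d)) :
    sampleTrace (ρ * A) = ∑ T, ∑ T', ⟪ket T', ρ (ket T)⟫_ℂ * ⟪ket T, A (ket T')⟫_ℂ := by
  rw [Finset.sum_comm, sampleTrace]
  exact Finset.sum_congr rfl fun T' _ => (sum_inner_ket_mul_inner_ket ρ A T' T').symm

theorem kleinState_tensOp_eq {d : ℕ} (g : (Fock ℤ →L[ℂ] Fock ℤ) →L[ℂ] ℂ)
    (ρ A : Fock (Fin d) →L[ℂ] Fock (Fin d)) (B : Fock ℤ →L[ℂ] Fock ℤ) :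
    kleinState g ρ (tensOp B A)
      = g B * initialState ρ (kleinPhase d * A * star (kleinPhase d)) := by
  have h : ∀ T T' : Finset (Fin d),
      block (klein d * tensOp B A * star (klein d) : CompOp d) T T'
        = ⟪ket T, (kleinPhase d * A * star (kleinPhase d)) (ket T')⟫_ℂ • B := by
    intro T T'
    rw [klein, star_tensOp, tensOp_mul_tensOp, tensOp_mul_tensOp, star_one, one_mul, mul_one]
    exact block_tens _ _ T T'
  rw [kleinState_apply, initialState, sampleTrace_mul, Finset.mul_sum]
  refine Finset.sum_congr rfl fun T _ => ?_
  rw [Finset.mul_sum]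
  refine Finset.sum_congr rfl fun T' _ => ?_
  rw [h, map_smul, smul_eq_mul]
  ring

theorem commute_kleinPhase {d : ℕ} {A : Fock (Fin d) →L[ℂ] Fock (Fin d)}
    (h : Commute (parity (Fin d)) A) : Commute (kleinPhase d) A := by
  unfold kleinPhase
  exact Commute.add_left ((Commute.one_left A).smul_left ((1 + Complex.I) / 2))
    (h.smul_left ((1 - Complex.I) / 2))

theorem kleinState_tensOp {d : ℕ} (g : (Fock ℤ →L[ℂ] Fock ℤ) →L[ℂ] ℂ)
    (ρ : Fock (Fin d) →L[ℂ] Fock (Fin d)) {A : Fock (Fin d) →L[ℂ] Fock (Fin d)}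
    (hA : Commute (parity (Fin d)) A) (B : Fock ℤ →L[ℂ] Fock ℤ) :
    kleinState g ρ (tensOp B A) = g B * initialState ρ A := by
  rw [kleinState_tensOp_eq, (commute_kleinPhase hA).eq, mul_assoc, kleinPhase_mul_star_self,
    mul_one]

/-- Each power of the step is a power of `kleinStep` conjugated by `klein`. The inner phases cancel
because `A` commutes with parity, and the outer ones are built into `kleinState`. The blocks of the
evolved observable lie in the reservoir algebra, where `g` and `ω` agree. -/
theorem sampleState_eq_kleinState {d : ℕ} [NeZero d] (hg : Extends g ω) (α : ℝ)
    (ρ : Fock (Fin d) →L[ℂ] Fock (Fin d)) (t : ℕ) {A : Fock (Fin d) →L[ℂ] Fock (Fin d)}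
    (hA : Commute (parity (Fin d)) A) :
    sampleState d α ω ρ t A = kleinState g ρ (heisenberg d α t (tensOp 1 A)) := by
  have h : klein d * heisenberg d α t (tensOp 1 A) * star (klein d)
      = star (stepOp d α ^ t) * tensOp 1 A * stepOp d α ^ t := by
    have h1 : star (klein d) * tensOp 1 A * klein d = tensOp 1 A := by
      rw [klein, star_tensOp, tensOp_mul_tensOp, tensOp_mul_tensOp, star_one, one_mul, mul_one,
        mul_assoc, ← (commute_kleinPhase hA).eq, ← mul_assoc, star_kleinPhase_mul_self, one_mul]
    rw [stepOp_pow, heisenberg_apply, star_mul, star_mul, star_star]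
    conv_lhs => rw [← h1]
    simp only [mul_assoc]
  rw [kleinState_apply, h]
  unfold sampleState productState
  refine Finset.sum_congr rfl fun T _ => Finset.sum_congr rfl fun T' _ => ?_
  congr 1
  exact (hg ⟨_, _⟩).symm

end Quasifree

/-! ### Reduced density matrices of the evolved state -/

/-- Commutation with the shift allows both indices to be translated by one; iterating in either
direction brings the first index to 0. -/
theorem inner_ket_apply_ket {Sg : L2 ℤ →L[ℂ] L2 ℤ} (hSg : Commute Sg reservoirShift) (j k : ℤ) :
    ⟪ket j, Sg (ket k)⟫_ℂ = symb Sg (k - j) := by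
  have hS : ∀ (f : L2 ℤ) (x : ℤ), (reservoirShift f) x = f (x + 1) := by
    intro f x
    rw [reservoirShift, permOp, substOp_apply, one_mul]
    simp [shiftInt]
  have hk : ∀ k : ℤ, reservoirShift (ket k) = ket (k - 1) := by
    intro k
    ext x
    rw [hS, ket_apply, ket_apply]
    simp only [eq_sub_iff_add_eq]
  have h1 : ∀ j k : ℤ, (Sg (ket k)) (j + 1) = (Sg (ket (k - 1))) j := by
    intro j k
    rw [← hk, ← hS, ← mul_apply_eq_comp, ← mul_apply_eq_comp, hSg.eq]
  rw [symb, inner_ket, inner_ket]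
  induction j with
  | zero => rw [sub_zero]
  | succ i ih =>
    have h2 : ∀ k : ℤ, (Sg (ket k)) (i : ℤ) = (Sg (ket (k - i))) 0 := by
      clear ih
      induction i with
      | zero => intro k; simp
      | succ i ih' =>
        intro k
        rw [Nat.cast_succ, h1, ih']
        ring_nf
    rw [h1, h2]
    ring_nf
  | pred i ih =>
    have h2 : ∀ k : ℤ, (Sg (ket k)) (-(i : ℤ)) = (Sg (ket (k + i))) 0 := by
      clear ih
      induction i with
      | zero => intro k; simp
      | succ i ih' =>
        intro k
        have := h1 (-((i + 1 : ℕ) : ℤ)) (k + 1)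
        rw [add_sub_cancel_right] at this
        rw [← this, Nat.cast_succ, neg_add, neg_add_cancel_right, ih']
        ring_nf
    have := h1 (-(i : ℤ) - 1) (k + 1)
    rw [add_sub_cancel_right, sub_add_cancel] at this
    rw [← this, h2]
    ring_nf

theorem emitted_mem {d : ℕ} (α : ℝ) (m : ℕ) (j : Fin d) : emitted α m j ∈ annihilationSpan ℤ :=
  Submodule.sum_mem _ fun _ _ => Submodule.smul_mem _ _ (Submodule.subset_span ⟨_, rfl⟩)

theorem star_emitted {d : ℕ} (α : ℝ) (m : ℕ) (j : Fin d) :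
    star (emitted α m j)
      = ∑ r ∈ Finset.range m, (-(Real.sin α : ℂ) * (Real.cos α : ℂ) ^ (m - 1 - r)) •
        creation ((r : ℤ) * d + j) := by
  rw [emitted, star_sum]
  refine Finset.sum_congr rfl fun r _ => ?_
  rw [star_smul, creation]
  congr 1
  rw [← starRingEnd_apply, map_mul, map_neg, map_pow, Complex.conj_ofReal, Complex.conj_ofReal]

theorem tensOp_one_list_prod {d : ℕ} (L : List (Fock (Fin d) →L[ℂ] Fock (Fin d))) :
    tensOp 1 L.prod = (L.map (tensOp 1)).prod := by
  induction L with
  | nil => exact tensOp_one_one d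
  | cons A L ih => rw [List.prod_cons, List.map_cons, List.prod_cons, ← ih, tensOp_mul_tensOp,
      one_mul]

theorem list_prod_map_tensOp {d : ℕ} (L : List (Fock ℤ →L[ℂ] Fock ℤ))
    (A : Fock (Fin d) →L[ℂ] Fock (Fin d)) :
    (L.map fun B => tensOp B A).prod = tensOp L.prod (A ^ L.length) := by
  induction L with
  | nil => exact (tensOp_one_one d).symm
  | cons B L ih => rw [List.prod_cons, List.map_cons, List.prod_cons, ih, tensOp_mul_tensOp,
      List.length_cons, pow_succ']

theorem mul_list_prod_of_anticommute {R : Type*} [Ring R] {θ : R} (L : List R)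
    (h : ∀ x ∈ L, θ * x = -(x * θ)) : θ * L.prod = (-1) ^ L.length * (L.prod * θ) := by
  induction L with
  | nil => simp
  | cons x L ih =>
    rw [List.prod_cons, ← mul_assoc, h x (by simp), neg_mul, mul_assoc, ih
      (fun y hy => h y (by simp [hy])), List.length_cons, pow_succ, mul_neg, mul_one, neg_mul,
      ← mul_assoc, ((Commute.neg_one_right x).pow_right _).eq]
    simp only [mul_assoc]

/-- The parity passes `p` creators and then `p` annihilators, and the two signs `(-1)^p` cancel. -/
theorem commute_parity_monomial {p d : ℕ} (k j : Fin p → Fin d) :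
    Commute (parity (Fin d)) (monomial k j) := by
  have h1 := mul_list_prod_of_anticommute (θ := parity (Fin d))
    (List.ofFn fun i => creation (k i)) (fun x hx => by
      obtain ⟨i, rfl⟩ := (List.mem_ofFn' _ _).1 hx
      exact parity_mul_creation _)
  have h2 := mul_list_prod_of_anticommute (θ := parity (Fin d))
    (List.ofFn fun i => annihilation (j i)).reverse (fun x hx => by
      obtain ⟨i, rfl⟩ := (List.mem_ofFn' _ _).1 (List.mem_reverse.1 hx)
      exact parity_mul_annihilation _)
  rw [List.length_ofFn] at h1
  rw [List.length_reverse, List.length_ofFn] at h2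
  have h3 : ∀ A : Fock (Fin d) →L[ℂ] Fock (Fin d), (-1) ^ p * ((-1) ^ p * A) = A := fun A => by
    rw [← mul_assoc, ← pow_add, ← two_mul, pow_mul, neg_one_sq, one_pow, one_mul]
  have h4 : ∀ A B : Fock (Fin d) →L[ℂ] Fock (Fin d), A * ((-1) ^ p * B) = (-1) ^ p * (A * B) :=
    fun A B => by rw [← mul_assoc, ((Commute.neg_one_right A).pow_right _).eq, mul_assoc]
  rw [Commute, SemiconjBy, monomial, ← mul_assoc, h1, mul_assoc, mul_assoc, h2, h4, h3, mul_assoc]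

theorem commute_parity_creation_mul_annihilation {d : ℕ} (k j : Fin d) :
    Commute (parity (Fin d)) (creation k * annihilation j) :=
  (commute_mul_of_anticommute (by rw [parity_mul_creation, neg_neg])
    (by rw [parity_mul_annihilation, neg_neg])).symm

section Evolved

variable {d : ℕ} {Sg : L2 ℤ →L[ℂ] L2 ℤ} {ω : reservoirAlgebra →L[ℂ] ℂ}
  {g : (Fock ℤ →L[ℂ] Fock ℤ) →L[ℂ] ℂ}

theorem two_point_emitted (hg : Extends g ω) (hω : IsQuasiFreeState Sg ω)
    (hSg : Commute Sg reservoirShift) (α : ℝ) (m : ℕ) (j k : Fin d) :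
    g (star (emitted α m k) * emitted α m j)
      = (Real.sin α : ℂ) ^ 2 * sigmaSum d α Sg m j k := by
  rw [star_emitted, emitted, Finset.sum_mul, map_sum, sigmaSum, Matrix.sum_apply, Finset.mul_sum]
  refine Finset.sum_congr rfl fun r hr => ?_
  rw [Finset.mul_sum, map_sum, Matrix.sum_apply, Finset.mul_sum]
  refine Finset.sum_congr rfl fun s hs => ?_
  rw [Finset.mem_range] at hr hs
  -- The truncated subtractions are exact because `r` and `s` are below `m`. The two factors
  -- `-sin(α)` multiply to `sin²(α)`.
  rw [smul_mul_assoc, mul_smul_comm, map_smul, map_smul, hg.map_creation_mul_annihilation hω,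
    inner_ket_apply_ket hSg, Matrix.smul_apply, sigmaMat, Matrix.of_apply,
    show 2 * (m - 1) - (r + s) = (m - 1 - r) + (m - 1 - s) by omega, pow_add,
    show (r : ℤ) * d + (k : ℕ) - ((s : ℤ) * d + (j : ℕ)) = (k : ℕ) - (j : ℕ) + ((r : ℤ) - s) * d by
      ring]
  simp only [smul_eq_mul]
  ring

theorem initialState_one {ρ : Fock (Fin d) →L[ℂ] Fock (Fin d)} (hρ : sampleTrace ρ = 1) :
    initialState ρ 1 = 1 := by
  rw [initialState, mul_one, hρ]

theorem kleinState_tensOp_of_eq_zero (ρ : Fock (Fin d) →L[ℂ] Fock (Fin d))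
    {B : Fock ℤ →L[ℂ] Fock ℤ} (hB : g B = 0) (A : Fock (Fin d) →L[ℂ] Fock (Fin d)) :
    kleinState g ρ (tensOp B A) = 0 := by
  rw [kleinState_tensOp_eq, hB, zero_mul]

/-- The `2p` parity factors multiply to the identity on the sample, so the trace of `ρ` contributes
1 and Wick's formula applies to the reservoir factor. -/
theorem kleinState_emitted_word (hg : Extends g ω) (hω : IsQuasiFreeState Sg ω)
    (hSg : Commute Sg reservoirShift) (α : ℝ) {ρ : Fock (Fin d) →L[ℂ] Fock (Fin d)}
    (hρ : sampleTrace ρ = 1) (m : ℕ) {p : ℕ} (k j : Fin p → Fin d) :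
    kleinState g ρ
        ((List.ofFn fun i => star (tensOp (emitted α m (k i)) (parity (Fin d)))).prod
          * (List.ofFn fun i => tensOp (emitted α m (j i)) (parity (Fin d))).reverse.prod)
      = (((Real.sin α : ℂ) ^ 2 • sigmaSum d α Sg m).submatrix j k).det := by
  have h1 : (List.ofFn fun i => star (tensOp (emitted α m (k i)) (parity (Fin d))))
      = (List.ofFn fun i => star (emitted α m (k i))).map fun B => tensOp B (parity (Fin d)) := by
    rw [List.map_ofFn]
    refine congrArg List.ofFn (funext fun i => ?_)
    rw [star_tensOp, star_parity]
    rfl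
  have h2 : (List.ofFn fun i => tensOp (emitted α m (j i)) (parity (Fin d))).reverse
      = (List.ofFn fun i => emitted α m (j i)).reverse.map fun B => tensOp B (parity (Fin d)) := by
    rw [List.map_reverse, List.map_ofFn]
    rfl
  rw [h1, h2, list_prod_map_tensOp, list_prod_map_tensOp, tensOp_mul_tensOp, List.length_reverse,
    List.length_ofFn, List.length_ofFn, ← (Commute.refl (parity (Fin d))).mul_pow, parity_mul_self,
    one_pow, kleinState_tensOp g ρ (Commute.one_right _), initialState_one hρ, mul_one,
    hg.map_eq_det hω (fun i => star_mem_creationSpan (emitted_mem α m _))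
      (fun i => emitted_mem α m _)]
  congr 1
  ext a c
  rw [Matrix.of_apply, two_point_emitted hg hω hSg]
  rfl

variable [NeZero d]

theorem sampleState_monomial (hg : Extends g ω) (α : ℝ) (ρ : Fock (Fin d) →L[ℂ] Fock (Fin d))
    (t : ℕ) {p : ℕ} (k j : Fin p → Fin d) :
    sampleState d α ω ρ t (monomial k j)
      = kleinState g ρ ((List.ofFn fun i => star (heisenberg d α t (sampleMode (k i)))).prod
        * (List.ofFn fun i => heisenberg d α t (sampleMode (j i))).reverse.prod) := by
  have h : tensOp 1 (monomial k j)
      = tensOp 1 (List.ofFn fun i => creation (k i)).prod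
        * tensOp 1 (List.ofFn fun i => annihilation (j i)).reverse.prod := by
    rw [tensOp_mul_tensOp, one_mul, monomial]
  rw [sampleState_eq_kleinState hg α ρ t (commute_parity_monomial k j), h, heisenberg_mul,
    tensOp_one_list_prod, tensOp_one_list_prod, heisenberg_list_prod, heisenberg_list_prod,
    List.map_reverse, List.map_reverse, List.map_ofFn, List.map_ofFn, List.map_ofFn, List.map_ofFn]
  congr 3
  refine congrArg List.ofFn (funext fun i => ?_)
  rw [← heisenberg_star, star_sampleMode]
  rfl

theorem star_heisenberg_sampleMode (α : ℝ) (m : ℕ) (j : Fin d) :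
    star (heisenberg d α (m * d) (sampleMode j))
      = (Real.cos α : ℂ) ^ m • tensOp 1 (creation j)
        + tensOp (star (emitted α m j)) (parity (Fin d)) := by
  rw [heisenberg_sampleMode, star_add, star_smul, star_sampleMode, star_tensOp, star_parity]
  congr 2
  rw [← starRingEnd_apply, map_pow, Complex.conj_ofReal]

/-- Each cross term contains a single emitted operator, whose expectation vanishes by gauge
invariance. -/
theorem oneBody_sampleState (hg : Extends g ω) (hω : IsQuasiFreeState Sg ω)
    (hSg : Commute Sg reservoirShift) (α : ℝ) {ρ : Fock (Fin d) →L[ℂ] Fock (Fin d)}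
    (hρ : sampleTrace ρ = 1) (m : ℕ) :
    oneBody (sampleState d α ω ρ (m * d))
      = (Real.cos α : ℂ) ^ (2 * m) • oneBody (initialState ρ)
        + (Real.sin α : ℂ) ^ 2 • sigmaSum d α Sg m := by
  ext j k
  have hk : g (star (emitted α m k)) = 0 := by
    simpa using hg.map_eq_zero hω (show 1 ≠ 0 by norm_num)
      (x := ![star (emitted α m k)]) (y := ![])
      (by simp [star_mem_creationSpan, emitted_mem]) (by simp)
  have hj : g (emitted α m j) = 0 := by
    simpa using hg.map_eq_zero hω (show 0 ≠ 1 by norm_num)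
      (x := ![]) (y := ![emitted α m j]) (by simp) (by simp [emitted_mem])
  have h : tensOp (d := d) 1 (creation k * annihilation j)
      = star (sampleMode k) * sampleMode j := by
    rw [star_sampleMode, sampleMode, tensOp_mul_tensOp, one_mul]
  rw [oneBody, Matrix.of_apply,
    sampleState_eq_kleinState hg α ρ _ (commute_parity_creation_mul_annihilation k j), h,
    heisenberg_mul, heisenberg_star, star_heisenberg_sampleMode, heisenberg_sampleMode, sampleMode]
  simp only [mul_add, add_mul, smul_mul_assoc, mul_smul_comm, tensOp_mul_tensOp, one_mul, mul_one,
    map_add, map_smul, parity_mul_self, kleinState_tensOp_of_eq_zero ρ hk,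
    kleinState_tensOp_of_eq_zero ρ hj, kleinState_tensOp g ρ (Commute.one_right _),
    kleinState_tensOp g ρ (commute_parity_creation_mul_annihilation k j), hg.map_one hω,
    initialState_one hρ, two_point_emitted hg hω hSg, Matrix.add_apply, Matrix.smul_apply,
    oneBody, Matrix.of_apply, smul_eq_mul]
  ring

theorem sampleState_monomial_two (hg : Extends g ω) (hω : IsQuasiFreeState Sg ω)
    (hSg : Commute Sg reservoirShift) (α : ℝ) {ρ : Fock (Fin d) →L[ℂ] Fock (Fin d)}
    (hρ : sampleTrace ρ = 1) (m : ℕ) (k j : Fin 2 → Fin d) :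
    sampleState d α ω ρ (m * d) (monomial k j)
      = (Real.cos α : ℂ) ^ (4 * m) * initialState ρ (monomial k j)
        + (2 * (Real.sin α : ℂ) ^ 2 * (Real.cos α : ℂ) ^ (2 * m)) *
          (star (wedge j) ⬝ᵥ (tensorMat ![oneBody (initialState ρ), sigmaSum d α Sg m]).mulVec
            (wedge k))
        + (Real.sin α : ℂ) ^ 4 *
          (star (wedge j) ⬝ᵥ (tensorMat ![sigmaSum d α Sg m, sigmaSum d α Sg m]).mulVec
            (wedge k)) := by
  have hx : ∀ i, star (emitted α m (k i)) ∈ creationSpan ℤ :=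
    fun i => star_mem_creationSpan (emitted_mem α m _)
  have hy : ∀ i, emitted α m (j i) ∈ annihilationSpan ℤ := fun i => emitted_mem α m _
  have hx1 : ∀ i, g (star (emitted α m (k i))) = 0 := fun i => by
    simpa using hg.map_eq_zero hω (show 1 ≠ 0 by norm_num)
      (x := ![star (emitted α m (k i))]) (y := ![]) (by simp [hx]) (by simp)
  have hy1 : ∀ i, g (emitted α m (j i)) = 0 := fun i => by
    simpa using hg.map_eq_zero hω (show 0 ≠ 1 by norm_num)
      (x := ![]) (y := ![emitted α m (j i)]) (by simp) (by simp [hy])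
  have hx2 : g (star (emitted α m (k 0)) * star (emitted α m (k 1))) = 0 := by
    simpa using hg.map_eq_zero hω (show 2 ≠ 0 by norm_num)
      (x := fun i => star (emitted α m (k i))) (y := ![]) hx (by simp)
  have hy2 : g (emitted α m (j 1) * emitted α m (j 0)) = 0 := by
    simpa using hg.map_eq_zero hω (show 0 ≠ 2 by norm_num)
      (x := ![]) (y := fun i => emitted α m (j i)) (by simp) hy
  have hx3 : ∀ i, g (star (emitted α m (k 0)) * star (emitted α m (k 1)) * emitted α m (j i)) = 0 :=
    fun i => by
    simpa [mul_assoc] using hg.map_eq_zero hω (show 2 ≠ 1 by norm_num)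
      (x := fun i => star (emitted α m (k i))) (y := ![emitted α m (j i)]) hx (by simp [hy])
  have hy3 : ∀ i, g (star (emitted α m (k i)) * (emitted α m (j 1) * emitted α m (j 0))) = 0 :=
    fun i => by
    simpa [mul_assoc] using hg.map_eq_zero hω (show 1 ≠ 2 by norm_num)
      (x := ![star (emitted α m (k i))]) (y := fun i => emitted α m (j i)) (by simp [hx]) hy
  have hdet : g (star (emitted α m (k 0)) * star (emitted α m (k 1))
        * (emitted α m (j 1) * emitted α m (j 0)))
      = (Real.sin α : ℂ) ^ 4 * (sigmaSum d α Sg m (j 0) (k 0) * sigmaSum d α Sg m (j 1) (k 1)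
        - sigmaSum d α Sg m (j 0) (k 1) * sigmaSum d α Sg m (j 1) (k 0)) := by
    have := hg.map_eq_det hω hx hy
    rw [Matrix.det_fin_two] at this
    simp only [Matrix.of_apply, two_point_emitted hg hω hSg] at this
    simp only [List.ofFn_succ, List.ofFn_zero, List.prod_cons, List.prod_nil, List.reverse_cons,
      List.reverse_nil, List.nil_append, List.prod_append, mul_one, Fin.succ_zero_eq_one]
      at this
    rw [this]
    ring
  have hmon : monomial k j
      = creation (k 0) * creation (k 1) * (annihilation (j 1) * annihilation (j 0)) := by
    simp [monomial, List.ofFn_succ]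
  set θ := parity (Fin d) with hθ
  have hE : ∀ a b, Commute θ (creation (k a) * annihilation (j b)) :=
    fun a b => commute_parity_creation_mul_annihilation _ _
  have hθc : ∀ a, θ * creation (k a) = -(creation (k a) * θ) := fun a => parity_mul_creation _
  have hθa : ∀ a, θ * annihilation (j a) = -(annihilation (j a) * θ) :=
    fun a => parity_mul_annihilation _
  have hθθ : θ * θ = 1 := parity_mul_self _
  -- In the four mixed words a sample creator and a sample annihilator survive between parities.
  -- Moving the parities together gives `+` when the creator and annihilator positions agree and `-`
  -- otherwise, which are the signs in `wedge_dotProduct_tensorMat_two`.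
  have w1 : creation (k 0) * θ * (θ * annihilation (j 0)) = creation (k 0) * annihilation (j 0) := by
    rw [mul_assoc, ← mul_assoc θ, hθθ, one_mul]
  have w2 : creation (k 0) * θ * (annihilation (j 1) * θ)
      = (-1 : ℂ) • (creation (k 0) * annihilation (j 1)) := by
    rw [mul_assoc, ← mul_assoc θ, hθa, neg_mul, mul_assoc, hθθ, mul_one, mul_neg, neg_one_smul]
  have w3 : θ * creation (k 1) * (θ * annihilation (j 0))
      = (-1 : ℂ) • (creation (k 1) * annihilation (j 0)) := by
    rw [hθc, neg_mul, mul_assoc, ← mul_assoc θ, hθθ, one_mul, neg_one_smul]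
  have w4 : θ * creation (k 1) * (annihilation (j 1) * θ)
      = creation (k 1) * annihilation (j 1) := by
    rw [hθc, neg_mul, mul_assoc, ← mul_assoc θ, hθa, neg_mul, mul_assoc, hθθ, mul_one, mul_neg,
      neg_neg]
  have hword : sampleState d α ω ρ (m * d) (monomial k j)
      = kleinState g ρ (star (heisenberg d α (m * d) (sampleMode (k 0)))
        * star (heisenberg d α (m * d) (sampleMode (k 1)))
        * (heisenberg d α (m * d) (sampleMode (j 1))
        * heisenberg d α (m * d) (sampleMode (j 0)))) := by
    rw [sampleState_monomial hg]
    simp [List.ofFn_succ]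
  have hmonθ : Commute θ
      (creation (k 0) * creation (k 1) * (annihilation (j 1) * annihilation (j 0))) := by
    rw [← hmon]
    exact commute_parity_monomial k j
  rw [hword, wedge_dotProduct_tensorMat_two, wedge_dotProduct_tensorMat_two, hmon]
  simp only [star_heisenberg_sampleMode]
  simp only [heisenberg_sampleMode]
  simp only [sampleMode, ← hθ]
  -- Of the sixteen products the ten with unequal numbers of emitted creators and annihilators are
  -- sent to 0.
  simp only [mul_add, add_mul, smul_mul_assoc, mul_smul_comm, tensOp_mul_tensOp, one_mul, mul_one,
    map_add, map_smul, hθθ, w1, w2, w3, w4, tensOp_smul_right,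
    kleinState_tensOp_of_eq_zero ρ (hx1 _), kleinState_tensOp_of_eq_zero ρ (hy1 _),
    kleinState_tensOp_of_eq_zero ρ hx2, kleinState_tensOp_of_eq_zero ρ hy2,
    kleinState_tensOp_of_eq_zero ρ (hx3 _), kleinState_tensOp_of_eq_zero ρ (hy3 _),
    kleinState_tensOp g ρ (Commute.one_right _), kleinState_tensOp g ρ (hE _ _),
    kleinState_tensOp g ρ hmonθ, hg.map_one hω,
    initialState_one hρ, two_point_emitted hg hω hSg, hdet, oneBody, Matrix.of_apply, smul_eq_mul]
  ring

theorem reducedDM_two_sampleState (hg : Extends g ω) (hω : IsQuasiFreeState Sg ω)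
    (hSg : Commute Sg reservoirShift) (α : ℝ) {ρ : Fock (Fin d) →L[ℂ] Fock (Fin d)}
    (hρ : sampleTrace ρ = 1) (m : ℕ) :
    reducedDM 2 (sampleState d α ω ρ (m * d))
      = (Real.cos α : ℂ) ^ (4 * m) • reducedDM 2 (initialState ρ)
        + (2 * (Real.sin α : ℂ) ^ 2 * (Real.cos α : ℂ) ^ (2 * m)) •
            (antisymProj 2 d * tensorMat ![oneBody (initialState ρ), sigmaSum d α Sg m]
              * antisymProj 2 d)
        + (Real.sin α : ℂ) ^ 4 •
            (antisymProj 2 d * tensorMat ![sigmaSum d α Sg m, sigmaSum d α Sg m]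
              * antisymProj 2 d) := by
  rw [antisymProj_mul_mul_antisymProj, antisymProj_mul_mul_antisymProj, reducedDM, reducedDM]
  simp only [Finset.smul_sum, ← Finset.sum_add_distrib, smul_smul, ← add_smul]
  refine Finset.sum_congr rfl fun j _ => Finset.sum_congr rfl fun k _ => ?_
  rw [sampleState_monomial_two hg hω hSg α hρ]

end Evolved

/-! ### Recursion in the number of periods -/

theorem sum_range_pow_smul_reflect {E : Type*} [AddCommGroup E] [Module ℂ E] (c : ℂ) (f : ℤ → E)
    (m : ℕ) :
    ∑ r ∈ Finset.range m, c ^ (m - r) • f ((m : ℤ) - r)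
      = ∑ u ∈ Finset.range m, c ^ (u + 1) • f ((u + 1 : ℕ) : ℤ) := by
  rw [← Finset.sum_range_reflect]
  refine Finset.sum_congr rfl fun u hu => ?_
  rw [Finset.mem_range] at hu
  rw [show m - (m - 1 - u) = u + 1 by omega]
  congr 2
  omega

theorem bMat_eq_sum_range (d : ℕ) (α : ℝ) (Sg : L2 ℤ →L[ℂ] L2 ℤ) (m : ℕ) :
    bMat d α Sg m = sigmaMat d Sg 0 + ∑ u ∈ Finset.range m, (Real.cos α : ℂ) ^ (u + 1) •
      (sigmaMat d Sg ((u + 1 : ℕ) : ℤ) + sigmaMat d Sg (-((u + 1 : ℕ) : ℤ))) := by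
  rw [bMat, Finset.range_eq_Ico, Finset.sum_Ico_add' (fun u : ℕ => (Real.cos α : ℂ) ^ u •
      (sigmaMat d Sg (u : ℤ) + sigmaMat d Sg (-(u : ℤ)))) 0 m 1]
  rfl

/-- Split the square of indices `r, s ≤ m` into the square `r, s < m`, where every exponent grows by
2, and the last row and column. The corner gives `σ^{(0)}`, and the two edges, read from the corner
outwards, give the powers of the cosine in `B(m)`. -/
theorem sigmaSum_succ (d : ℕ) (α : ℝ) (Sg : L2 ℤ →L[ℂ] L2 ℤ) (m : ℕ) :
    sigmaSum d α Sg (m + 1) = (Real.cos α : ℂ) ^ 2 • sigmaSum d α Sg m + bMat d α Sg m := by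
  rw [bMat_eq_sum_range, sigmaSum, Finset.sum_range_succ]
  have h1 : ∀ r ∈ Finset.range m, ∑ s ∈ Finset.range (m + 1),
      (Real.cos α : ℂ) ^ (2 * (m + 1 - 1) - (r + s)) • sigmaMat d Sg ((r : ℤ) - (s : ℤ))
      = (Real.cos α : ℂ) ^ 2 • (∑ s ∈ Finset.range m,
          (Real.cos α : ℂ) ^ (2 * (m - 1) - (r + s)) • sigmaMat d Sg ((r : ℤ) - (s : ℤ)))
        + (Real.cos α : ℂ) ^ (m - r) • sigmaMat d Sg (-((m : ℤ) - r)) := by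
    intro r hr
    rw [Finset.mem_range] at hr
    rw [Finset.sum_range_succ, Finset.smul_sum, neg_sub,
      show 2 * (m + 1 - 1) - (r + m) = m - r by omega]
    congr 1
    refine Finset.sum_congr rfl fun s hs => ?_
    rw [Finset.mem_range] at hs
    rw [smul_smul, ← pow_add,
      show 2 * (m + 1 - 1) - (r + s) = 2 + (2 * (m - 1) - (r + s)) by omega]
  have h2 : ∑ s ∈ Finset.range (m + 1),
      (Real.cos α : ℂ) ^ (2 * (m + 1 - 1) - (m + s)) • sigmaMat d Sg ((m : ℤ) - (s : ℤ))
      = ∑ s ∈ Finset.range m, (Real.cos α : ℂ) ^ (m - s) • sigmaMat d Sg ((m : ℤ) - (s : ℤ))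
        + sigmaMat d Sg 0 := by
    rw [Finset.sum_range_succ, show 2 * (m + 1 - 1) - (m + m) = 0 by omega, pow_zero, one_smul,
      sub_self]
    congr 1
    refine Finset.sum_congr rfl fun s hs => ?_
    rw [show 2 * (m + 1 - 1) - (m + s) = m - s by omega]
  rw [Finset.sum_congr rfl h1, h2, Finset.sum_add_distrib, ← Finset.smul_sum,
    sum_range_pow_smul_reflect _ (fun u => sigmaMat d Sg (-u)),
    sum_range_pow_smul_reflect _ (fun u => sigmaMat d Sg u), sigmaSum]
  simp only [smul_add, Finset.sum_add_distrib]
  abel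

/-- `P_A (A ⊗ B) P_A`, bilinear in `A` and `B`. -/
def antisymTensor {d : ℕ} :
    Matrix (Fin d) (Fin d) ℂ →ₗ[ℂ] Matrix (Fin d) (Fin d) ℂ →ₗ[ℂ] TensorOp 2 d :=
  LinearMap.mk₂ ℂ (fun A B => antisymProj 2 d * tensorMat ![A, B] * antisymProj 2 d)
    (fun A A' B => by
      rw [← add_mul, ← mul_add]
      congr 2
      ext x y
      simp [tensorMat, Fin.prod_univ_two, add_mul])
    (fun c A B => by
      rw [← smul_mul_assoc, ← mul_smul_comm]
      congr 2
      ext x y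
      simp [tensorMat, Fin.prod_univ_two, mul_assoc])
    (fun A B B' => by
      rw [← add_mul, ← mul_add]
      congr 2
      ext x y
      simp [tensorMat, Fin.prod_univ_two, mul_add])
    (fun c A B => by
      rw [← smul_mul_assoc, ← mul_smul_comm]
      congr 2
      ext x y
      simp [tensorMat, Fin.prod_univ_two, mul_left_comm])

theorem antisymTensor_apply {d : ℕ} (A B : Matrix (Fin d) (Fin d) ℂ) :
    antisymTensor A B = antisymProj 2 d * tensorMat ![A, B] * antisymProj 2 d := rfl

theorem antisymTensor_comm {d : ℕ} (A B : Matrix (Fin d) (Fin d) ℂ) :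
    antisymTensor A B = antisymTensor B A := antisymProj_tensorMat_comm A B

/-! ### Limits -/

/-- The limit `R` is the fixed point of `x ↦ q x + (1 - q) R`. The distance to it contracts by `‖q‖`
at each step, up to a forcing by `y m - R` that tends to 0. -/
theorem tendsto_of_affine_recursion {q : ℂ} (hq : ‖q‖ < 1) {x y : ℕ → ℂ} {R : ℂ}
    (h : ∀ m, x (m + 1) = q * x m + (1 - q) * y m) (hy : Tendsto y atTop (𝓝 R)) :
    Tendsto x atTop (𝓝 R) := by
  have hq' : 0 < 1 - ‖q‖ := sub_pos.2 hq
  rw [Metric.tendsto_atTop] at hy ⊢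
  intro ε hε
  have hb : 0 < ‖1 - q‖ + 1 := by positivity
  -- The threshold bounds the forcing by `ε / 2 * (1 - ‖q‖)`, exactly what restores the bound `ε /
  -- 2` after it is contracted by `‖q‖`. The added 1 keeps the denominator visibly positive.
  obtain ⟨N, hN⟩ := hy (ε / 2 * (1 - ‖q‖) / (‖1 - q‖ + 1)) (by positivity)
  have key : ∀ k : ℕ, ‖x (N + k) - R‖ ≤ ‖q‖ ^ k * ‖x N - R‖ + ε / 2 := by
    intro k
    induction k with
    | zero => simp; positivity
    | succ k ih =>
      have h1 : x (N + (k + 1)) - R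
          = q * (x (N + k) - R) + (1 - q) * (y (N + k) - R) := by
        rw [← add_assoc, h]
        ring
      have h2 : ‖1 - q‖ * ‖y (N + k) - R‖ ≤ ε / 2 * (1 - ‖q‖) := by
        have h3 := (hN (N + k) (Nat.le_add_right _ _)).le
        rw [dist_eq_norm, le_div_iff₀ hb] at h3
        nlinarith [norm_nonneg (y (N + k) - R)]
      calc ‖x (N + (k + 1)) - R‖ ≤ ‖q‖ * ‖x (N + k) - R‖ + ‖1 - q‖ * ‖y (N + k) - R‖ := by
            rw [h1, ← norm_mul, ← norm_mul]
            exact norm_add_le _ _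
        _ ≤ ‖q‖ * (‖q‖ ^ k * ‖x N - R‖ + ε / 2) + ε / 2 * (1 - ‖q‖) :=
            add_le_add (mul_le_mul_of_nonneg_left ih (norm_nonneg q)) h2
        _ = ‖q‖ ^ (k + 1) * ‖x N - R‖ + ε / 2 := by ring
  have h0 : Tendsto (fun k : ℕ => ‖q‖ ^ k * ‖x N - R‖) atTop (𝓝 0) := by
    simpa using (tendsto_pow_atTop_nhds_zero_of_lt_one (norm_nonneg q) hq).mul_const ‖x N - R‖
  obtain ⟨M, hM⟩ := ((tendsto_order.1 h0).2 (ε / 2) (half_pos hε)).exists_forall_of_atTop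
  refine ⟨N + M, fun n hn => ?_⟩
  obtain ⟨k, rfl⟩ := Nat.exists_eq_add_of_le (show N ≤ n by omega)
  rw [dist_eq_norm]
  linarith [key k, hM k (by omega)]

theorem norm_symb_le (Sg : L2 ℤ →L[ℂ] L2 ℤ) (k : ℤ) : ‖symb Sg k‖ ≤ ‖Sg‖ := by
  have h1 : ∀ k : ℤ, ‖(ket k : L2 ℤ)‖ = 1 := fun k => by
    let := Classical.decEq ℤ
    exact (lp.norm_single (E := fun _ : ℤ => ℂ) (by norm_num) k (1 : ℂ)).trans norm_one
  calc ‖symb Sg k‖ ≤ ‖(ket 0 : L2 ℤ)‖ * ‖Sg (ket k)‖ := norm_inner_le_norm _ _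
    _ ≤ 1 * (‖Sg‖ * ‖(ket k : L2 ℤ)‖) := by
        rw [h1]
        exact mul_le_mul_of_nonneg_left (Sg.le_opNorm _) zero_le_one
    _ = ‖Sg‖ := by rw [h1, one_mul, mul_one]

theorem exists_tendsto_bMat (d : ℕ) {α : ℝ} (hα : ‖(Real.cos α : ℂ)‖ < 1)
    (Sg : L2 ℤ →L[ℂ] L2 ℤ) :
    ∃ R : Matrix (Fin d) (Fin d) ℂ, Tendsto (bMat d α Sg) atTop (𝓝 R) := by
  have h : ∀ i j : Fin d, Summable fun u : ℕ => (Real.cos α : ℂ) ^ (u + 1) *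
      (sigmaMat d Sg ((u + 1 : ℕ) : ℤ) i j + sigmaMat d Sg (-((u + 1 : ℕ) : ℤ)) i j) := by
    intro i j
    refine Summable.of_norm_bounded (g := fun u : ℕ => ‖(Real.cos α : ℂ)‖ ^ (u + 1) * (2 * ‖Sg‖))
      (((summable_nat_add_iff 1).2 (summable_geometric_of_lt_one (norm_nonneg _) hα)).mul_right _)
      fun u => ?_
    rw [norm_mul, norm_pow]
    refine mul_le_mul_of_nonneg_left ?_ (by positivity)
    refine (norm_add_le _ _).trans ?_
    rw [two_mul]
    exact add_le_add (norm_symb_le _ _) (norm_symb_le _ _)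
  refine ⟨Matrix.of fun i j => sigmaMat d Sg 0 i j + ∑' u : ℕ, (Real.cos α : ℂ) ^ (u + 1) *
      (sigmaMat d Sg ((u + 1 : ℕ) : ℤ) i j + sigmaMat d Sg (-((u + 1 : ℕ) : ℤ)) i j), ?_⟩
  refine tendsto_pi_nhds.2 fun i => tendsto_pi_nhds.2 fun j => ?_
  refine ((h i j).hasSum.tendsto_sum_nat.const_add (sigmaMat d Sg 0 i j)).congr fun m => ?_
  rw [bMat_eq_sum_range, Matrix.add_apply, Matrix.sum_apply]
  rfl

/-! ### Replacing evolved modes by their reservoir parts -/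

/-- Two bounded sequences with vanishing difference. -/
structure AsympEq {R : Type*} [NormedRing R] (X Y : ℕ → R) : Prop where
  left : X =O[atTop] (1 : ℕ → ℝ)
  right : Y =O[atTop] (1 : ℕ → ℝ)
  sub : (fun m => X m - Y m) =o[atTop] (1 : ℕ → ℝ)

/-- Telescoping: `X X' - Y Y' = (X - Y) X' + Y (X' - Y')`, with one small and one bounded factor in
each term. -/
theorem AsympEq.mul {R : Type*} [NormedRing R] {X Y X' Y' : ℕ → R} (h : AsympEq X Y)
    (h' : AsympEq X' Y') : AsympEq (fun m => X m * X' m) fun m => Y m * Y' m where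
  left := (h.left.mul h'.left).congr_right fun _ => mul_one (1 : ℝ)
  right := (h.right.mul h'.right).congr_right fun _ => mul_one (1 : ℝ)
  sub := by
    have h1 : (fun m => (X m - Y m) * X' m) =o[atTop] (1 : ℕ → ℝ) :=
      (h.sub.mul_isBigO h'.left).congr_right fun _ => mul_one (1 : ℝ)
    have h2 : (fun m => Y m * (X' m - Y' m)) =o[atTop] (1 : ℕ → ℝ) :=
      (h.right.mul_isLittleO h'.sub).congr_right fun _ => mul_one (1 : ℝ)
    refine (h1.add h2).congr_left fun m => ?_
    noncomm_ring

theorem AsympEq.star {R : Type*} [NormedRing R] [StarRing R] [NormedStarGroup R] {X Y : ℕ → R}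
    (h : AsympEq X Y) : AsympEq (fun m => star (X m)) fun m => star (Y m) where
  left := (Asymptotics.IsBigO.of_norm_left (by simpa using h.left.norm_left))
  right := (Asymptotics.IsBigO.of_norm_left (by simpa using h.right.norm_left))
  sub := (Asymptotics.IsLittleO.of_norm_left
    (by simpa only [← star_sub, norm_star] using h.sub.norm_left))

theorem AsympEq.list_prod {R κ : Type*} [NormedRing R] (L : List κ) {X Y : κ → ℕ → R}
    (h : ∀ i, AsympEq (X i) (Y i)) :
    AsympEq (fun m => (L.map fun i => X i m).prod) fun m => (L.map fun i => Y i m).prod := by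
  induction L with
  | nil =>
    have h1 : (fun _ : ℕ => (1 : R)) =O[atTop] (1 : ℕ → ℝ) :=
      Asymptotics.isBigO_const_const _ one_ne_zero _
    exact ⟨by simpa using h1, by simpa using h1, by simp⟩
  | cons i L ih => simpa using (h i).mul ih

theorem norm_heisenberg {d : ℕ} [NeZero d] (α : ℝ) (t : ℕ) (X : CompOp d) :
    ‖heisenberg d α t X‖ = ‖X‖ := by
  have h1 : kleinStep d α ^ t ∈ unitary (CompOp d) :=
    Unitary.mem_iff.2 ⟨star_kleinStep_pow_mul_self d α t, kleinStep_pow_mul_star_self d α t⟩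
  rw [heisenberg_apply, CStarRing.norm_mul_mem_unitary _ h1,
    CStarRing.norm_mem_unitary_mul _ (Unitary.star_mem h1)]

/-- The difference is `cos^m(α) a_j`, which tends to 0 in norm. Boundedness holds because the
evolution is conjugation by a unitary. -/
theorem asympEq_emitted {d : ℕ} [NeZero d] {α : ℝ} (hα : ‖(Real.cos α : ℂ)‖ < 1) (j : Fin d) :
    AsympEq (fun m => heisenberg d α (m * d) (sampleMode j))
      fun m => tensOp (emitted α m j) (parity (Fin d)) := by
  have h1 : (fun m => heisenberg d α (m * d) (sampleMode j)) =O[atTop] (1 : ℕ → ℝ) :=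
    Asymptotics.IsBigO.of_bound ‖sampleMode j‖ (Eventually.of_forall fun m => by
      simp [norm_heisenberg])
  have h2 : (fun m => heisenberg d α (m * d) (sampleMode j)
      - tensOp (emitted α m j) (parity (Fin d))) =o[atTop] (1 : ℕ → ℝ) := by
    refine (Asymptotics.isLittleO_one_iff ℝ).2 ?_
    have h3 := (tendsto_pow_atTop_nhds_zero_of_norm_lt_one hα).smul_const (sampleMode j)
    rw [zero_smul] at h3
    refine h3.congr fun m => ?_
    rw [heisenberg_sampleMode, add_sub_cancel_right]
  refine ⟨h1, ?_, h2⟩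
  refine (h1.sub h2.isBigO).congr_left fun m => ?_
  rw [sub_sub_cancel]

section Limit

variable {d : ℕ} {Sg : L2 ℤ →L[ℂ] L2 ℤ} {ω : reservoirAlgebra →L[ℂ] ℂ}
  {g : (Fock ℤ →L[ℂ] Fock ℤ) →L[ℂ] ℂ} {α : ℝ} {R : Matrix (Fin d) (Fin d) ℂ}

theorem tendsto_sigmaSum (hα : ‖(Real.cos α : ℂ)‖ < 1) (hR : Tendsto (bMat d α Sg) atTop (𝓝 R)) :
    Tendsto (fun m => (Real.sin α : ℂ) ^ 2 • sigmaSum d α Sg m) atTop (𝓝 R) := by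
  have hq : ‖(Real.cos α : ℂ) ^ 2‖ < 1 := by
    rw [norm_pow]
    exact pow_lt_one₀ (norm_nonneg _) hα two_ne_zero
  have hs : (1 : ℂ) - (Real.cos α : ℂ) ^ 2 = (Real.sin α : ℂ) ^ 2 := by
    rw [sub_eq_iff_eq_add]
    exact_mod_cast (Real.sin_sq_add_cos_sq α).symm
  refine tendsto_pi_nhds.2 fun i => tendsto_pi_nhds.2 fun j => ?_
  refine tendsto_of_affine_recursion hq (y := fun m => bMat d α Sg m i j) (fun m => ?_)
    (tendsto_pi_nhds.1 (tendsto_pi_nhds.1 hR i) j)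
  rw [sigmaSum_succ, hs]
  simp only [Matrix.smul_apply, Matrix.add_apply, smul_eq_mul]
  ring

variable [NeZero d]

/-- The word of evolved modes and the word of emitted ones are asymptotically equal in norm, so the
continuous functional `kleinState` gives them the same limit. The second word is a minor of a
convergent matrix. -/
theorem tendsto_sampleState_monomial (hg : Extends g ω) (hω : IsQuasiFreeState Sg ω)
    (hSg : Commute Sg reservoirShift) {ρ : Fock (Fin d) →L[ℂ] Fock (Fin d)}
    (hρ : sampleTrace ρ = 1) (hα : ‖(Real.cos α : ℂ)‖ < 1)
    (hR : Tendsto (bMat d α Sg) atTop (𝓝 R)) {p : ℕ} (k j : Fin p → Fin d) :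
    Tendsto (fun m : ℕ => sampleState d α ω ρ (m * d) (monomial k j)) atTop
      (𝓝 (R.submatrix j k).det) := by
  have h1 := ((AsympEq.list_prod (List.ofFn k) fun i => (asympEq_emitted hα i).star).mul
    (AsympEq.list_prod (List.ofFn j).reverse fun i => asympEq_emitted hα i)).sub
  have h2 := ((kleinState g ρ).continuous.tendsto 0).comp ((Asymptotics.isLittleO_one_iff ℝ).1 h1)
  have h3 : Tendsto (fun m => (((Real.sin α : ℂ) ^ 2 • sigmaSum d α Sg m).submatrix j k).det) atTop
      (𝓝 (R.submatrix j k).det) := by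
    have hc : Continuous fun A : Matrix (Fin d) (Fin d) ℂ => (A.submatrix j k).det :=
      (continuous_id.matrix_submatrix j k).matrix_det
    exact (hc.tendsto R).comp (tendsto_sigmaSum hα hR)
  have h4 := h2.add h3
  rw [map_zero, zero_add] at h4
  refine h4.congr fun m => ?_
  rw [Function.comp_apply, map_sub, sampleState_monomial hg,
    ← kleinState_emitted_word hg hω hSg α hρ m k j]
  simp only [List.map_reverse, List.map_ofFn]
  exact sub_add_cancel _ _

end Limit

end Walkers

end

/-! ### The theorem -/

theorem mainTheorem7 (d : ℕ) [NeZero d] (α : ℝ)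
    (Sg : L2 ℤ →L[ℂ] L2 ℤ) (hSg₀ : 0 ≤ Sg) (hSg₁ : Sg ≤ 1) (hSg : Commute Sg reservoirShift)
    (ω : reservoirAlgebra →L[ℂ] ℂ) (hω : IsQuasiFreeState Sg ω)
    (ρ : Fock (Fin d) →L[ℂ] Fock (Fin d)) (hρ : 0 ≤ ρ) (hρ₁ : sampleTrace ρ = 1) :
    (∀ m : ℕ,
      reducedDM 2 (sampleState d α ω ρ (m * d))
        = (Real.cos α : ℂ) ^ (4 * m) • reducedDM 2 (initialState ρ)
          + (2 * (Real.sin α : ℂ) ^ 2 * (Real.cos α : ℂ) ^ (2 * m)) •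
              (antisymProj 2 d * tensorMat ![oneBody (initialState ρ), sigmaSum d α Sg m]
                * antisymProj 2 d)
          + (Real.sin α : ℂ) ^ 4 •
              (antisymProj 2 d * tensorMat ![sigmaSum d α Sg m, sigmaSum d α Sg m]
                * antisymProj 2 d)) ∧
    (∀ m : ℕ,
      reducedDM 2 (sampleState d α ω ρ ((m + 1) * d))
        = (Real.cos α : ℂ) ^ 4 • reducedDM 2 (sampleState d α ω ρ (m * d))
          + (Real.sin α : ℂ) ^ 2 •
              (antisymProj 2 d
                * ((Real.cos α : ℂ) ^ 2 •
                      (tensorMat ![bMat d α Sg m, oneBody (sampleState d α ω ρ (m * d))]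
                        + tensorMat ![oneBody (sampleState d α ω ρ (m * d)), bMat d α Sg m])
                    + (Real.sin α : ℂ) ^ 2 • tensorMat ![bMat d α Sg m, bMat d α Sg m])
                * antisymProj 2 d)) ∧
    ((∀ n : ℤ, α ≠ n * Real.pi) →
      ∃ R : Matrix (Fin d) (Fin d) ℂ,
        Tendsto (bMat d α Sg) atTop (𝓝 R) ∧
        Tendsto (fun m : ℕ => oneBody (sampleState d α ω ρ (m * d))) atTop (𝓝 R) ∧
        ∀ p : ℕ, 1 ≤ p → p ≤ d →
          Tendsto (fun m : ℕ => reducedDM p (sampleState d α ω ρ (m * d))) atTop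
            (𝓝 (antisymProj p d * tensorMat (fun _ => R) * antisymProj p d))) := by
  obtain ⟨g, hg⟩ := exists_extends ω
  refine ⟨reducedDM_two_sampleState hg hω hSg α hρ₁, fun m => ?_, fun hα => ?_⟩
  · rw [reducedDM_two_sampleState hg hω hSg α hρ₁, reducedDM_two_sampleState hg hω hSg α hρ₁,
      oneBody_sampleState hg hω hSg α hρ₁, sigmaSum_succ, mul_add (antisymProj 2 d),
      mul_smul_comm, mul_smul_comm, mul_add (antisymProj 2 d), add_mul, smul_mul_assoc,
      smul_mul_assoc, add_mul]
    -- Both sides become expressions in the symmetric bilinear map `antisymTensor`; after `M(m+1)`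
    -- and the one-body matrix are expanded, the recursion is an identity between its coefficients.
    simp only [← antisymTensor_apply, map_add, map_smul, LinearMap.add_apply, LinearMap.smul_apply,
      antisymTensor_comm (bMat d α Sg m)]
    module
  · have hcos : ‖(Real.cos α : ℂ)‖ < 1 := by
      rw [Complex.norm_real, Real.norm_eq_abs]
      refine lt_of_le_of_ne (Real.abs_cos_le_one α) fun h => ?_
      have h1 : Real.sin α ^ 2 = 0 := by
        have := Real.sin_sq_add_cos_sq α
        rw [← sq_abs (Real.cos α), h] at this
        linarith
      obtain ⟨n, hn⟩ := Real.sin_eq_zero_iff.1 (pow_eq_zero_iff two_ne_zero |>.1 h1)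
      exact hα n hn.symm
    obtain ⟨R, hR⟩ := exists_tendsto_bMat d hcos Sg
    refine ⟨R, hR, ?_, fun p _ _ => ?_⟩
    · have h1 : Tendsto (fun m : ℕ => (Real.cos α : ℂ) ^ (2 * m) • oneBody (initialState ρ)) atTop
          (𝓝 0) := by
        have h2 : ‖(Real.cos α : ℂ) ^ 2‖ < 1 := by
          rw [norm_pow]
          exact pow_lt_one₀ (norm_nonneg _) hcos two_ne_zero
        have h3 := (tendsto_pow_atTop_nhds_zero_of_norm_lt_one h2).smul_const
          (oneBody (initialState ρ))
        rw [zero_smul] at h3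
        exact h3.congr fun m => by rw [pow_mul]
      have h4 := h1.add (tendsto_sigmaSum hcos hR)
      rw [zero_add] at h4
      exact h4.congr fun m => (oneBody_sampleState hg hω hSg α hρ₁ m).symm
    · rw [antisymProj_mul_mul_antisymProj]
      refine tendsto_finsetSum _ fun j _ => tendsto_finsetSum _ fun k _ => ?_
      rw [wedge_dotProduct_tensorMat_const]
      exact (tendsto_sampleState_monomial hg hω hSg hρ₁ hcos hR k j).smul_const _
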